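/- Let $\mathcal X$ be a measurable space, let $\mathcal Y$ be a finite output set with $|\mathcal Y| = c$, and let $D$ be a probability distribution on $\mathcal X\times\mathcal Y$. Let $L:\mathcal Y\times\mathcal Y\to\mathbb R_+$ be a definite loss, that is, $L(y,y')=0$ if and only if $y=y'$, and let $M=\max_{y,y'}L(y,y')$. To each labeled example $(x,y)$ a factor graph $G(x,y)$ with finitely many factor nodes $F(x,y)$ is assigned, whose variable nodes stand for the substructures of outputs. For a factor node $f$, let $\mathcal Y_f$ be the (finite) product of the label sets of the substructures adjacent to $f$, and let $y'_f\in\mathcal Y_f$ be the restriction of an output $y'$. All scoring functions $h:\mathcal X\times\mathcal Y\to\mathbb R$ below are given with a decomposition $h(x,y')=\sum_{f\in F(x,y)}h_f(x,y'_f)$ for all $y'\in\mathcal Y$ (where $h_f$ may depend on the example $(x,y)$ to whose graph $f$ belongs). For a sample $S=((x_1,y_1),\dots,(x_m,y_m))$, with $F_i=F(x_i,y_i)$, the empirical factor graph Rademacher complexity of a family $H$ of such functions is $$\widehat{\mathfrak R}^G_S(H)=\frac1m\,\mathbb E_{\epsilon}\Big[\sup_{h\in H}\sum_{i=1}^m\sum_{f\in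 F_i}\sum_{y\in\mathcal Y_f}\sqrt{|F_i|}\;\epsilon_{i,f,y}\,h_f(x_i,y)\Big]\in(-\infty,+\infty],$$ where the $\epsilon_{i,f,y}$ are independent and uniform on $\{\pm1\}$. Let $p\ge 2$ and let $H_1,\dots,H_p$ be families of scoring functions with values in $[0,1]$, measurable in $x$, each of them pointwise separable (it contains a countable subfamily such that every member of the family is the pointwise limit of a sequence in the subfamily). Let $\mathcal F=\operatorname{conv}(\bigcup_{k}H_k)$ be the family of all $f=\sum_{t=1}^T\alpha_t h_t$ with $T\ge1$, $\alpha$ in the probability simplex and $h_t\in H_{k_t}$, $k_t\in\{1,\dots,p\}$. For $f\in\mathcal F$ let $\mathsf f$ be any measurable predictor with $\mathsf f(x)\in\operatorname{argmax}_{y}f(x,y)$ for all $x$, and let $R(f)=\mathbb E_{(x,y)\sim D}[L(\mathsf f(x),y)]$. For $\rho>0$, with $\Phi^*(r)=\min(M,\max(0,r))$, let $$\widehat R^{\rm add}_{S,\rho,1}(f)=\frac1m\sum_{i=1}^m\Phi^*\Big(\max_{y'\ne y_i}\Big\{L(y',y_i)+1-\tfrac1\rho\,[f(x_i,y_i)-f(x_i,y')]\Big\}\Big),$$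 $$\widehat R^{\rm mult}_{S,\rho,1}(f)=\frac1m\sum_{i=1}^m\Phi^*\Big(\max_{y'\ne y_i}L(y',y_i)\Big(1+1-\tfrac1\rho\,[f(x_i,y_i)-f(x_i,y')]\Big)\Big).$$ Fix $\rho>0$ and $m\ge1$. For any $\delta>0$, with probability at least $1-\delta$ over the draw of a sample $S\sim D^m$, both of the following inequalities hold for all $f\in\mathcal F$, for every representation $f=\sum_{t=1}^T\alpha_t h_t$ as above and for every such predictor $\mathsf f$: $$R(f)-\widehat R^{\rm add}_{S,\rho,1}(f)\le\frac{4\sqrt2}{\rho}\sum_{t=1}^T\alpha_t\,\widehat{\mathfrak R}^G_S(H_{k_t})+C(\rho,M,c,m,p),$$ $$R(f)-\widehat R^{\rm mult}_{S,\rho,1}(f)\le\frac{4\sqrt2\,M}{\rho}\sum_{t=1}^T\alpha_t\,\widehat{\mathfrak R}^G_S(H_{k_t})+C(\rho,M,c,m,p),$$ where $$C(\rho,M,c,m,p)=\frac{2M}{\rho}\sqrt{\frac{\log p}{m}}+9M\sqrt{\Big\lceil\tfrac4{\rho^2}\log\Big(\tfrac{c^2\rho^2m}{4\log p}\Big)\Big\rceil\frac{\log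 p}{m}+\frac{\log\frac2\delta}{2m}}.$$ (The convention $0\cdot\infty=0$ is used, and the square root of a negative number is read as $0$.) -/

import Mathlib

open Set Filter Topology MeasureTheory

universe u v w

/-- A factor graph `(V, F, E)`: variable nodes `V = [numVars]`, factor nodes `F = [numFactors]`
and undirected edges between a variable node and a factor node. -/
structure FactorGraph where
  numVars : ℕ
  numFactors : ℕ
  edges : Finset (Fin numVars × Fin numFactors)

/-- The set of variable nodes that are connected to the factor node `f` by an edge. -/
def FactorGraph.nbhd (Γ : FactorGraph) (f : Fin Γ.numFactors) : Finset (Fin Γ.numVars) :=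
  Finset.univ.filter fun k => (k, f) ∈ Γ.edges

/-- A factor graph on the substructures of the output space `Y`: the variable node `k` stands for
the `k`-th substructure, whose finite set of labels is `Label k`, and `coord y k` is the label that
`y` gives to it. If `Y` is the product of the sets `Label k`, then `coord` is the identity. Since
the graph is allowed to vary with the example (also in its number of variable nodes) while `Y` is
fixed, `coord` is not required to be a bijection. -/
structure OutputGraph (Y : Type u) where
  graph : FactorGraph
  Label : Fin graph.numVars → Type v
  labelFintype : ∀ k, Fintype (Label k)
  coord : Y → ∀ k, Label k

namespace OutputGraph

variable {Y : Type u}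

/-- The index set of the factor nodes. -/
abbrev Factor (Γ : OutputGraph.{u, v} Y) : Type := Fin Γ.graph.numFactors

/-- The set `Y_f`: the product of the label sets over the neighbors of the factor node `f`. -/
abbrev FactorLabel (Γ : OutputGraph.{u, v} Y) (f : Γ.Factor) : Type v :=
  ∀ k : {k // k ∈ Γ.graph.nbhd f}, Γ.Label k.1

instance (Γ : OutputGraph.{u, v} Y) (k : Fin Γ.graph.numVars) : Fintype (Γ.Label k) :=
  Γ.labelFintype k

/-- The restriction `y_f` of an output `y` to the neighbors of the factor node `f`. -/
def restrict (Γ : OutputGraph.{u, v} Y) (f : Γ.Factor) (y : Y) : Γ.FactorLabel f :=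
  fun k => Γ.coord y k.1

end OutputGraph

/-- A real scoring function with its decomposition along factor graphs, where the graph `G (x, y)`
may depend on the labeled example: `h(x, y') = ∑_{f ∈ F(x, y)} h_f(x, y'_f)` for all outputs `y'`. -/
structure FactoredScore {X : Type w} {Y : Type u} (G : X × Y → OutputGraph.{u, v} Y) where
  score : X → Y → ℝ
  factor : ∀ (z : X × Y) (f : (G z).Factor), (G z).FactorLabel f → ℝ
  score_eq : ∀ (x : X) (y y' : Y),
    score x y' = ∑ f, factor (x, y) f ((G (x, y)).restrict f y')

noncomputable section

variable {X : Type w} {Y : Type u}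

/-- The indices `(i, f, y)`, `i ∈ [m]`, `f ∈ F_i`, `y ∈ Y_f`, of the Rademacher variables. -/
abbrev SignIndex (G : X × Y → OutputGraph.{u, v} Y) {m : ℕ} (S : Fin m → X × Y) : Type v :=
  Σ i : Fin m, Σ f : (G (S i)).Factor, (G (S i)).FactorLabel f

open Classical in
/-- The empirical factor graph Rademacher complexity of the family `H` on the sample `S`. The
expectation is the average over all sign vectors `ε` with values in `{1, -1}`. The supremum is taken
in the extended reals, so that it is `+∞` when it is not finite. -/
def empRademacher (G : X × Y → OutputGraph.{u, v} Y) {m : ℕ} (S : Fin m → X × Y)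
    (H : Set (FactoredScore G)) : EReal :=
  ((1 / (m : ℝ) * (1 / (2 : ℝ) ^ Fintype.card (SignIndex G S)) : ℝ) : EReal) *
    ∑ ε : SignIndex G S → ℤˣ, ⨆ h ∈ H,
      ((∑ i : Fin m, ∑ f : (G (S i)).Factor, ∑ y : (G (S i)).FactorLabel f,
        Real.sqrt ((G (S i)).graph.numFactors : ℝ) * (((ε ⟨i, f, y⟩ : ℤˣ) : ℤ) : ℝ) *
          h.factor (S i) f y : ℝ) : EReal)

/-- `M`, the largest value of the loss (over a finite output space). -/
def lossMax (L : Y → Y → ℝ) : ℝ := ⨆ p : Y × Y, L p.1 p.2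

/-- Truncation to the interval `[0, M]`. -/
def truncate (M r : ℝ) : ℝ := min M (max 0 r)

/-- The additive margin loss of the scoring function `h`, with margin term `τ`, at `(x, y)`. -/
def addLoss (L : Y → Y → ℝ) (ρ τ : ℝ) (h : X → Y → ℝ) (x : X) (y : Y) : ℝ :=
  truncate (lossMax L) (⨆ y' : {y' : Y // y' ≠ y}, (L y' y + τ - 1 / ρ * (h x y - h x y')))

/-- The multiplicative margin loss of the scoring function `h`, with margin term `τ`, at
`(x, y)`. -/
def multLoss (L : Y → Y → ℝ) (ρ τ : ℝ) (h : X → Y → ℝ) (x : X) (y : Y) : ℝ :=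
  truncate (lossMax L) (⨆ y' : {y' : Y // y' ≠ y}, (L y' y * (1 + τ - 1 / ρ * (h x y - h x y'))))

/-- The average of `φ` over the sample `S`. -/
def sampleMean {m : ℕ} (S : Fin m → X × Y) (φ : X → Y → ℝ) : ℝ :=
  1 / (m : ℝ) * ∑ i, φ (S i).1 (S i).2

/-- The empirical additive margin loss. -/
def empAddRisk (L : Y → Y → ℝ) {m : ℕ} (S : Fin m → X × Y) (ρ τ : ℝ) (h : X → Y → ℝ) : ℝ :=
  sampleMean S (addLoss L ρ τ h)

/-- The empirical multiplicative margin loss. -/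
def empMultRisk (L : Y → Y → ℝ) {m : ℕ} (S : Fin m → X × Y) (ρ τ : ℝ) (h : X → Y → ℝ) : ℝ :=
  sampleMean S (multLoss L ρ τ h)

/-- `g` is a predictor defined by the scoring function `h`: `g(x)` maximizes `h(x, ·)`. -/
def IsPredictor (h : X → Y → ℝ) (g : X → Y) : Prop := ∀ x y, h x y ≤ h x (g x)

/-- The generalization error of the predictor `g`. -/
def risk [MeasurableSpace X] [MeasurableSpace Y] (D : Measure (X × Y)) (L : Y → Y → ℝ)
    (g : X → Y) : ℝ :=
  ∫ z, L (g z.1) z.2 ∂D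

/-- A family of functions with a countable subfamily such that every member of the family is the
pointwise limit of a sequence in the subfamily. -/
def PointwiseSeparable (A : Set (X → Y → ℝ)) : Prop :=
  ∃ B ⊆ A, B.Countable ∧ ∀ a ∈ A, ∃ b : ℕ → X → Y → ℝ,
    (∀ n, b n ∈ B) ∧ ∀ x y, Tendsto (fun n => b n x y) atTop (𝓝 (a x y))

/-- The scoring function `∑ₜ αₜ hₜ`. -/
def ensemble {G : X × Y → OutputGraph.{u, v} Y} {T : ℕ} (α : Fin T → ℝ)
    (h : Fin T → FactoredScore G) : X → Y → ℝ :=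
  fun x y => ∑ t, α t * (h t).score x y

/-- The term `C(ρ, M, c, m, p)` of the bound at the confidence level `δ`. -/
def vrmConst (ρ M : ℝ) (c m p : ℕ) (δ : ℝ) : ℝ :=
  2 * M / ρ * Real.sqrt (Real.log p / m) +
    9 * M * Real.sqrt
      ((⌈4 / ρ ^ 2 * Real.log ((c : ℝ) ^ 2 * ρ ^ 2 * m / (4 * Real.log p))⌉ : ℝ) *
          (Real.log p / m) + Real.log (2 / δ) / (2 * m))

end

/-! The ensemble `f` is approximated by a random average of `n` of its members, drawn independently
with the weights `α` (Maurey sampling). An average whose components come from prescribed families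
lies in one of `p ^ n` classes that do not depend on `α`, so a union bound over these classes costs
only `n log p`, and the resulting event is uniform in `α`, `T` and the chosen members.

For one class, `exists_tuple_deviation_event` compares the true and empirical margin losses with
margin term 1/2. McDiarmid's inequality is applied once, to the supremum of the deviations minus
twice the Rademacher average of the losses; symmetrization makes the mean of this quantity
nonpositive. On every sample, `rademacherAvg_marginLoss_le` bounds that Rademacher average by factor
graph complexities: at the `i`-th example the margin loss is Lipschitz in the factor scores with
constant `√(2|F_i|) B/ρ`, where `B = 1` (additive) or `B = M` (multiplicative), and a vector
contraction resting on Khintchine's inequality with constant 2 removes the loss. Symmetrization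
contributes another 2, in total `4√2 B/ρ`.

Averaging over the draws (`risk_le_of_tuple_bounds`) turns the mean complexity of a tuple into `∑
α_t R_t`. By Hoeffding's inequality a given score difference of the random average exceeds that of
`f` by more than `ρ/2` with probability at most `e = exp(-nρ²/8)`. So the loss of the predictor is
at most the averaged loss with margin term 1/2, up to `M e`, and this is at most the loss of `f`
with margin term 1, up to `(c-1) M e`. The value of `n` makes `c e ≤ (2/ρ)√(log p / m)`. -/

/-! ### Rademacher signs: moments, Khintchine's inequality, vector contraction. -/

section Signs

open scoped BigOperators

/-- The real number `±1` given by a sign. -/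
abbrev signVal (s : ℤˣ) : ℝ := ((s : ℤ) : ℝ)

lemma signVal_sq (s : ℤˣ) : signVal s ^ 2 = 1 := by
  rcases Int.units_eq_one_or s with rfl | rfl <;> simp [signVal]

variable {J : Type*} [DecidableEq J]

lemma sum_sign_flip {s : Finset J} {a : J} (ha : a ∉ s) (w : J → ℝ) (ε : J → ℤˣ) :
    ∑ j ∈ s, signVal ((ε * Pi.mulSingle a (-1) : J → ℤˣ) j) * w j = ∑ j ∈ s, signVal (ε j) * w j := by
  refine Finset.sum_congr rfl fun j hj => ?_
  have : j ≠ a := fun h => ha (h ▸ hj)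
  simp [Pi.mulSingle_eq_of_ne this]

variable [Fintype J]

/-- Flipping the sign at `a` preserves the uniform law and negates the product. -/
lemma expect_sign_mul_eq_zero (a : J) (F : (J → ℤˣ) → ℝ)
    (hF : ∀ ε, F (ε * Pi.mulSingle a (-1)) = F ε) :
    𝔼 ε : J → ℤˣ, signVal (ε a) * F ε = 0 := by
  have h : 𝔼 ε : J → ℤˣ, signVal (ε a) * F ε = 𝔼 ε : J → ℤˣ, -(signVal (ε a) * F ε) := by
    refine Fintype.expect_equiv (Equiv.mulRight (Pi.mulSingle a (-1 : ℤˣ))) _ _ fun ε => ?_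
    simp [hF, signVal]
  rw [Finset.expect_neg_distrib] at h
  linarith

lemma expect_sum_sign_sq (w : J → ℝ) (s : Finset J) :
    𝔼 ε : J → ℤˣ, (∑ j ∈ s, signVal (ε j) * w j) ^ 2 = ∑ j ∈ s, w j ^ 2 := by
  induction s using Finset.induction_on with
  | empty => simp
  | insert a s ha ih =>
    have key : ∀ ε : J → ℤˣ, (∑ j ∈ insert a s, signVal (ε j) * w j) ^ 2 =
        w a ^ 2 + signVal (ε a) * (2 * w a * ∑ j ∈ s, signVal (ε j) * w j) +
          (∑ j ∈ s, signVal (ε j) * w j) ^ 2 := fun ε => by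
      rw [Finset.sum_insert ha]
      linear_combination w a ^ 2 * signVal_sq (ε a)
    simp_rw [key, Finset.expect_add_distrib]
    rw [ih, expect_sign_mul_eq_zero a _ fun ε => by rw [sum_sign_flip ha], Finset.sum_insert ha,
      Fintype.expect_const]
    ring

/-- Terms odd in the newly inserted sign average to zero; the cross term `6 w² ∑ w_j²` matches that
of the squared right side, which leaves `w⁴ ≤ 3 w⁴`. -/
lemma expect_sum_sign_pow_four_le (w : J → ℝ) (s : Finset J) :
    𝔼 ε : J → ℤˣ, (∑ j ∈ s, signVal (ε j) * w j) ^ 4 ≤ 3 * (∑ j ∈ s, w j ^ 2) ^ 2 := by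
  induction s using Finset.induction_on with
  | empty => simp
  | insert a s ha ih =>
    have key : ∀ ε : J → ℤˣ, (∑ j ∈ insert a s, signVal (ε j) * w j) ^ 4 =
        w a ^ 4 + 6 * w a ^ 2 * (∑ j ∈ s, signVal (ε j) * w j) ^ 2 +
        signVal (ε a) * (4 * w a ^ 3 * (∑ j ∈ s, signVal (ε j) * w j) +
          4 * w a * (∑ j ∈ s, signVal (ε j) * w j) ^ 3) +
          (∑ j ∈ s, signVal (ε j) * w j) ^ 4 := fun ε => by
      rw [Finset.sum_insert ha]
      set x := ∑ j ∈ s, signVal (ε j) * w j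
      linear_combination (w a ^ 4 * (signVal (ε a) ^ 2 + 1) + 6 * w a ^ 2 * x ^ 2 +
        4 * w a ^ 3 * signVal (ε a) * x) * signVal_sq (ε a)
    simp_rw [key, Finset.expect_add_distrib]
    rw [expect_sign_mul_eq_zero a _ fun ε => by rw [sum_sign_flip ha], Finset.sum_insert ha,
      Fintype.expect_const, ← Finset.mul_expect, expect_sum_sign_sq]
    nlinarith [sq_nonneg (w a ^ 2)]

/-- Khintchine's inequality for the first moment, with the constant `2`. -/
lemma sqrt_sum_sq_le_two_mul_expect (w : J → ℝ) :
    √(∑ j, w j ^ 2) ≤ 2 * 𝔼 ε : J → ℤˣ, |∑ j, signVal (ε j) * w j| := by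
  have hnn : 0 ≤ 𝔼 ε : J → ℤˣ, |∑ j, signVal (ε j) * w j| :=
    Finset.expect_nonneg fun ε _ => abs_nonneg _
  set σ := √(∑ j, w j ^ 2) with hσ
  have hσ2 : σ ^ 2 = ∑ j, w j ^ 2 := Real.sq_sqrt (Finset.sum_nonneg fun j _ => sq_nonneg _)
  rcases (Real.sqrt_nonneg (∑ j, w j ^ 2)).eq_or_lt with h0 | h0
  · rw [hσ, ← h0]; positivity
  rw [← hσ] at h0
  -- This bounds the first moment from below by the second and fourth. The gap factors as `|t| (|t|
  -- - 2σ)² (|t| + 4σ)`; averaging yields the constant 16/9, below 2.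
  have hpt : ∀ t : ℝ, 12 * σ ^ 2 * t ^ 2 - t ^ 4 ≤ 16 * σ ^ 3 * |t| := fun t => by
    have ht := abs_nonneg t
    have : 0 ≤ |t| * ((|t| - 2 * σ) ^ 2 * (|t| + 4 * σ)) := by positivity
    have h2 : |t| ^ 2 = t ^ 2 := sq_abs t
    have h4 : |t| ^ 4 = t ^ 4 := by rw [show |t| ^ 4 = (|t| ^ 2) ^ 2 by ring, h2]; ring
    rw [← h2, ← h4]
    linarith
  have hsum : 12 * σ ^ 2 * σ ^ 2 - 3 * (σ ^ 2) ^ 2 ≤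
      16 * σ ^ 3 * 𝔼 ε : J → ℤˣ, |∑ j, signVal (ε j) * w j| := by
    calc _ ≤ 12 * σ ^ 2 * (𝔼 ε : J → ℤˣ, (∑ j, signVal (ε j) * w j) ^ 2) -
          𝔼 ε : J → ℤˣ, (∑ j, signVal (ε j) * w j) ^ 4 := by
          rw [expect_sum_sign_sq, hσ2]
          linarith [expect_sum_sign_pow_four_le w Finset.univ]
      _ = 𝔼 ε : J → ℤˣ, (12 * σ ^ 2 * (∑ j, signVal (ε j) * w j) ^ 2 -
          (∑ j, signVal (ε j) * w j) ^ 4) := by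
          rw [Finset.expect_sub_distrib, Finset.mul_expect]
      _ ≤ _ := by
          rw [Finset.mul_expect]
          exact Finset.expect_le_expect fun ε _ => hpt _
  have h3 : 0 < σ ^ 3 := by positivity
  have : σ ^ 3 * (9 * σ) ≤ σ ^ 3 * (16 * 𝔼 ε : J → ℤˣ, |∑ j, signVal (ε j) * w j|) := by
    linarith
  have := le_of_mul_le_mul_left this h3
  linarith

section Contraction

variable {Θ : Type*} [Finite Θ] [Nonempty Θ]

/-- The contraction step for one sample point. At the two maximizers, the Lipschitz bound gives a
Euclidean norm, Khintchine turns it into a mean absolute value, and either sign of the inner sum is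
covered by giving one maximizer `+` and the other `-`. -/
lemma ciSup_add_ciSup_le_expect (ψ A : Θ → ℝ) (v : J → Θ → ℝ)
    (hψ : ∀ θ θ', ψ θ - ψ θ' ≤ √(∑ j, (v j θ - v j θ') ^ 2)) :
    (⨆ θ, (A θ + ψ θ)) + (⨆ θ, (A θ - ψ θ)) ≤
      2 * 𝔼 ζ : J → ℤˣ, ⨆ θ, (A θ + 2 * ∑ j, signVal (ζ j) * v j θ) := by
  obtain ⟨θ, hθ⟩ := exists_eq_ciSup_of_finite (f := fun θ => A θ + ψ θ)
  obtain ⟨θ', hθ'⟩ := exists_eq_ciSup_of_finite (f := fun θ => A θ - ψ θ)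
  have hneg : 𝔼 ζ : J → ℤˣ, ⨆ θ, (A θ + 2 * ∑ j, signVal (ζ j) * v j θ) =
      𝔼 ζ : J → ℤˣ, ⨆ θ, (A θ - 2 * ∑ j, signVal (ζ j) * v j θ) := by
    refine Fintype.expect_equiv (Equiv.neg _) _ _ fun ζ => ?_
    simp [signVal]
  have hub : ∀ (f : Θ → ℝ) θ, f θ ≤ ⨆ θ, f θ := fun f θ => le_ciSup (finite_range f).bddAbove θ
  calc (⨆ θ, (A θ + ψ θ)) + (⨆ θ, (A θ - ψ θ))
      ≤ A θ + A θ' + √(∑ j, (v j θ - v j θ') ^ 2) := by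
        rw [← hθ, ← hθ']; linarith [hψ θ θ']
    _ ≤ A θ + A θ' + 2 * 𝔼 ζ : J → ℤˣ, |∑ j, signVal (ζ j) * (v j θ - v j θ')| := by
        gcongr; exact sqrt_sum_sq_le_two_mul_expect _
    _ = 𝔼 ζ : J → ℤˣ, (A θ + A θ' + 2 * |∑ j, signVal (ζ j) * (v j θ - v j θ')|) := by
        rw [Finset.expect_add_distrib, Fintype.expect_const, Finset.mul_expect]
    _ ≤ 𝔼 ζ : J → ℤˣ, ((⨆ θ, (A θ + 2 * ∑ j, signVal (ζ j) * v j θ)) +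
          ⨆ θ, (A θ - 2 * ∑ j, signVal (ζ j) * v j θ)) := by
        refine Finset.expect_le_expect fun ζ _ => ?_
        have h1 := hub (fun θ => A θ + 2 * ∑ j, signVal (ζ j) * v j θ)
        have h2 := hub (fun θ => A θ - 2 * ∑ j, signVal (ζ j) * v j θ)
        have h3 : ∑ j, signVal (ζ j) * (v j θ - v j θ') =
            ∑ j, signVal (ζ j) * v j θ - ∑ j, signVal (ζ j) * v j θ' := by
          simp_rw [mul_sub, Finset.sum_sub_distrib]
        rw [h3]
        rcases abs_cases (∑ j, signVal (ζ j) * v j θ - ∑ j, signVal (ζ j) * v j θ') with h | h <;>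
          rw [h.1]
        · linarith [h1 θ, h2 θ']
        · linarith [h1 θ', h2 θ]
    _ = _ := by rw [Finset.expect_add_distrib, ← hneg]; ring

lemma expect_signs_unit (f : ℤˣ → ℝ) : 𝔼 s : ℤˣ, f s = (f 1 + f (-1)) / 2 := by
  rw [Fintype.expect_eq_sum_div_card]
  simp [UnitsInt.univ]

lemma expect_fin_succ {m : ℕ} {β : Fin (m + 1) → Type*} [∀ i, Fintype (β i)]
    (F : (∀ i, β i) → ℝ) :
    𝔼 e, F e = 𝔼 a : β 0, 𝔼 e : ∀ i : Fin m, β i.succ, F (Fin.cons a e) := by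
  rw [← Finset.expect_product', Finset.univ_product_univ]
  exact (Fintype.expect_equiv (Fin.consEquiv β) _ _ fun e => rfl).symm

/-- The contraction principle for vector valued classes. -/
lemma expect_ciSup_contraction {m : ℕ} (J : Fin m → Type v) [∀ i, Fintype (J i)]
    [∀ i, DecidableEq (J i)] (A : Θ → ℝ) (ψ : Fin m → Θ → ℝ) (v : ∀ i, J i → Θ → ℝ)
    (hψ : ∀ i θ θ', ψ i θ - ψ i θ' ≤ √(∑ j, (v i j θ - v i j θ') ^ 2)) :
    𝔼 ε : Fin m → ℤˣ, ⨆ θ, (A θ + ∑ i, signVal (ε i) * ψ i θ) ≤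
      𝔼 η : ∀ i, J i → ℤˣ, ⨆ θ, (A θ + 2 * ∑ i, ∑ j, signVal (η i j) * v i j θ) := by
  -- `A` stays general because it absorbs the term of the sample point that is not being contracted.
  induction m generalizing A with
  | zero => simp
  | succ m ih =>
    rw [expect_fin_succ, expect_fin_succ]
    calc _ = 𝔼 s : ℤˣ, 𝔼 ε : Fin m → ℤˣ, ⨆ θ, ((A θ + signVal s * ψ 0 θ) +
            ∑ i, signVal (ε i) * ψ i.succ θ) := by
          simp only [Fin.sum_univ_succ, Fin.cons_zero, Fin.cons_succ, add_assoc]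
      _ ≤ 𝔼 s : ℤˣ, 𝔼 η : ∀ i : Fin m, J i.succ → ℤˣ, ⨆ θ, ((A θ + signVal s * ψ 0 θ) +
            2 * ∑ i : Fin m, ∑ j, signVal (η i j) * v i.succ j θ) :=
          Finset.expect_le_expect fun s _ => ih (fun i => J i.succ) _ (fun i => ψ i.succ)
            (fun i => v i.succ) fun i => hψ i.succ
      _ = 𝔼 η : ∀ i : Fin m, J i.succ → ℤˣ,
            ((⨆ θ, ((A θ + 2 * ∑ i : Fin m, ∑ j, signVal (η i j) * v i.succ j θ) + ψ 0 θ)) +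
             (⨆ θ, ((A θ + 2 * ∑ i : Fin m, ∑ j, signVal (η i j) * v i.succ j θ) - ψ 0 θ))) / 2 := by
          rw [Finset.expect_comm]
          refine Finset.expect_congr rfl fun η _ => ?_
          rw [expect_signs_unit]
          congr 3 <;> ext θ <;> simp [signVal] <;> ring
      _ ≤ 𝔼 η : ∀ i : Fin m, J i.succ → ℤˣ, 𝔼 ζ : J 0 → ℤˣ,
            ⨆ θ, ((A θ + 2 * ∑ i : Fin m, ∑ j, signVal (η i j) * v i.succ j θ) +
              2 * ∑ j, signVal (ζ j) * v 0 j θ) := by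
          refine Finset.expect_le_expect fun η _ => ?_
          linarith [ciSup_add_ciSup_le_expect (ψ 0)
            (fun θ => A θ + 2 * ∑ i : Fin m, ∑ j, signVal (η i j) * v i.succ j θ) (v 0) (hψ 0)]
      _ = _ := by
          rw [Finset.expect_comm]
          refine Finset.expect_congr rfl fun ζ _ => Finset.expect_congr rfl fun η _ => ?_
          congr 1; ext θ
          simp only [Fin.sum_univ_succ, Fin.cons_zero, Fin.cons_succ]
          ring

end Contraction

end Signs

/-! ### McDiarmid's inequality. -/

section BoundedDifferences

open ProbabilityTheory

variable {Z : Type*} [MeasurableSpace Z]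

lemma piFinSuccAbove_symm_eq_cons {m : ℕ} :
    ⇑(MeasurableEquiv.piFinSuccAbove (fun _ : Fin (m + 1) => Z) 0).symm =
      fun q : Z × (Fin m → Z) => (Fin.cons q.1 q.2 : Fin (m + 1) → Z) := by
  ext q i
  refine Fin.cases ?_ (fun j => ?_) i <;> simp [MeasurableEquiv.piFinSuccAbove]

lemma measurable_fin_cons {m : ℕ} :
    Measurable fun q : Z × (Fin m → Z) => (Fin.cons q.1 q.2 : Fin (m + 1) → Z) := by
  rw [← piFinSuccAbove_symm_eq_cons]
  exact MeasurableEquiv.measurable _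

variable (μ : Measure Z) [IsProbabilityMeasure μ]

lemma integral_pi_succ {m : ℕ} (f : (Fin (m + 1) → Z) → ℝ) :
    ∫ S, f S ∂(Measure.pi fun _ => μ) =
      ∫ q, f (Fin.cons q.1 q.2) ∂(μ.prod (Measure.pi fun _ : Fin m => μ)) := by
  have h := (measurePreserving_piFinSuccAbove (fun _ : Fin (m + 1) => μ) 0).symm
  rw [← h.integral_comp (MeasurableEquiv.measurableEmbedding _), piFinSuccAbove_symm_eq_cons]

/-- Hoeffding's lemma on the interval of length `c` that starts at the infimum of `X`: the
oscillation alone enters the bound, while `a` keeps the infimum finite. -/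
lemma integral_exp_sub_integral_le {X : Z → ℝ} (hX : Measurable X) {a b c : ℝ} (hc : 0 ≤ c)
    (hab : ∀ z, X z ∈ Icc a b) (hb : ∀ z z', X z - X z' ≤ c) (t : ℝ) :
    ∫ z, Real.exp (t * (X z - ∫ z, X z ∂μ)) ∂μ ≤ Real.exp ((c / 2) ^ 2 * t ^ 2 / 2) := by
  have : Nonempty Z := nonempty_of_isProbabilityMeasure μ
  have hbdd : BddBelow (range X) := ⟨a, by rintro _ ⟨z, rfl⟩; exact (hab z).1⟩
  have h : ∀ z, X z ∈ Icc (⨅ z, X z) ((⨅ z, X z) + c) := fun z =>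
    ⟨ciInf_le hbdd z, by
      have : X z - c ≤ ⨅ z, X z := le_ciInf fun z' => by linarith [hb z z']
      linarith⟩
  have := (hasSubgaussianMGF_of_mem_Icc hX.aemeasurable (ae_of_all μ h)).mgf_le t
  simpa [mgf, abs_of_nonneg hc] using this

/-- Condition on the first coordinate: the conditional mean `g` inherits the oscillation bound and
is handled by Hoeffding's lemma, the remaining fluctuation by induction. The range `[a, b]` gives
integrability only. -/
lemma integral_exp_pi_le {m : ℕ} (F : (Fin m → Z) → ℝ) (hF : Measurable F) {a b c : ℝ}
    (hc : 0 ≤ c) (hab : ∀ S, F S ∈ Icc a b)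
    (hb : ∀ S i z, F S - F (Function.update S i z) ≤ c) (t : ℝ) :
    ∫ S, Real.exp (t * (F S - ∫ S, F S ∂(Measure.pi fun _ => μ))) ∂(Measure.pi fun _ => μ) ≤
      Real.exp (m * (c / 2) ^ 2 * t ^ 2 / 2) := by
  induction m with
  | zero => simp [Subsingleton.elim _ (default : Fin 0 → Z)]
  | succ m ih =>
    set ν := Measure.pi fun _ : Fin m => μ
    have hΨ : Measurable fun q : Z × (Fin m → Z) => F (Fin.cons q.1 q.2) :=
      hF.comp measurable_fin_cons
    set g : Z → ℝ := fun z => ∫ S, F (Fin.cons z S) ∂ν with hg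
    have hgm : Measurable g := hΨ.stronglyMeasurable.integral_prod_right.measurable
    have hint : ∀ z, Integrable (fun S => F (Fin.cons z S)) ν := fun z =>
      Integrable.of_mem_Icc a b (hΨ.comp measurable_prodMk_left).aemeasurable
        (ae_of_all _ fun S => hab _)
    have hΨint : Integrable (fun q : Z × (Fin m → Z) => F (Fin.cons q.1 q.2)) (μ.prod ν) :=
      Integrable.of_mem_Icc a b hΨ.aemeasurable (ae_of_all _ fun S => hab _)
    have hgab : ∀ z, g z ∈ Icc a b := fun z => by
      constructor
      · simpa using integral_mono (integrable_const a) (hint z) fun S => (hab _).1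
      · simpa using integral_mono (hint z) (integrable_const b) fun S => (hab _).2
    have hgb : ∀ z z', g z - g z' ≤ c := fun z z' => by
      rw [hg]
      simp only
      rw [← integral_sub (hint z) (hint z')]
      have := integral_mono ((hint z).sub (hint z')) (integrable_const c) fun S => by
        have := hb (Fin.cons z S) 0 z'
        rwa [Fin.update_cons_zero] at this
      simpa using this
    have hE : ∫ S, F S ∂(Measure.pi fun _ => μ) = ∫ z, g z ∂μ := by
      rw [integral_pi_succ, integral_prod _ hΨint]
    have hbexp : ∀ x ∈ Icc a b, ∀ y ∈ Icc a b, Real.exp (t * (x - y)) ∈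
        Icc 0 (Real.exp (|t| * (b - a))) := fun x hx y hy => by
      refine ⟨(Real.exp_pos _).le, Real.exp_le_exp.2 ?_⟩
      calc t * (x - y) ≤ |t| * |x - y| := by rw [← abs_mul]; exact le_abs_self _
        _ ≤ _ := by
          gcongr
          exact abs_sub_le_of_le_of_le hx.1 hx.2 hy.1 hy.2
    have hEab : ∫ z, g z ∂μ ∈ Icc a b := by
      have hgi : Integrable g μ := Integrable.of_mem_Icc a b hgm.aemeasurable (ae_of_all _ hgab)
      constructor
      · simpa using integral_mono (integrable_const a) hgi fun z => (hgab z).1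
      · simpa using integral_mono hgi (integrable_const b) fun z => (hgab z).2
    rw [hE, integral_pi_succ, integral_prod]
    swap
    · exact Integrable.of_mem_Icc _ _ (by
        exact ((hΨ.sub_const _).const_mul t).exp.aemeasurable)
        (ae_of_all _ fun q => hbexp _ (hab _) _ hEab)
    calc _ = ∫ z, (∫ S, Real.exp (t * (F (Fin.cons z S) - g z)) ∂ν) *
            Real.exp (t * (g z - ∫ z, g z ∂μ)) ∂μ := by
          refine integral_congr_ae (ae_of_all _ fun z => ?_)
          simp only
          rw [← integral_mul_const]
          refine integral_congr_ae (ae_of_all _ fun S => ?_)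
          simp only
          rw [← Real.exp_add]
          ring_nf
      _ ≤ ∫ z, Real.exp (m * (c / 2) ^ 2 * t ^ 2 / 2) *
            Real.exp (t * (g z - ∫ z, g z ∂μ)) ∂μ := by
          refine integral_mono_of_nonneg (ae_of_all _ fun z => ?_) ?_ (ae_of_all _ fun z => ?_)
          · exact mul_nonneg (integral_nonneg fun S => (Real.exp_pos _).le) (Real.exp_pos _).le
          · exact (Integrable.of_mem_Icc _ _ (by fun_prop)
              (ae_of_all _ fun z => hbexp _ (hgab z) _ hEab)).const_mul _
          · refine mul_le_mul_of_nonneg_right ?_ (Real.exp_pos _).le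
            refine ih (fun S => F (Fin.cons z S)) (hΨ.comp measurable_prodMk_left)
              (fun S => hab _) fun S i z' => ?_
            have := hb (Fin.cons z S) i.succ z'
            rwa [← Fin.cons_update] at this
      _ ≤ Real.exp (m * (c / 2) ^ 2 * t ^ 2 / 2) * Real.exp ((c / 2) ^ 2 * t ^ 2 / 2) := by
          rw [integral_const_mul]
          gcongr
          exact integral_exp_sub_integral_le μ hgm hc hgab hgb t
      _ = _ := by
          rw [← Real.exp_add]
          push_cast
          ring_nf

/-- McDiarmid's bounded differences inequality. -/
theorem measureReal_pi_le_exp_of_bounded_differences {m : ℕ} (F : (Fin m → Z) → ℝ)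
    (hF : Measurable F) {a b c : ℝ} (hc : 0 ≤ c) (hab : ∀ S, F S ∈ Icc a b)
    (hb : ∀ S i z, F S - F (Function.update S i z) ≤ c) {r : ℝ} (hr : 0 ≤ r) :
    (Measure.pi fun _ : Fin m => μ).real
        {S | r ≤ F S - ∫ S, F S ∂(Measure.pi fun _ => μ)} ≤
      Real.exp (-r ^ 2 / (2 * (m * (c / 2) ^ 2))) := by
  set ν := Measure.pi fun _ : Fin m => μ
  have h : HasSubgaussianMGF (fun S => F S - ∫ S, F S ∂ν) (m * (⟨c, hc⟩ / 2) ^ 2) ν := by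
    constructor
    · intro t
      have : ∀ S, F S - ∫ S, F S ∂ν ∈ Icc (a - ∫ S, F S ∂ν) (b - ∫ S, F S ∂ν) := fun S =>
        ⟨by linarith [(hab S).1], by linarith [(hab S).2]⟩
      exact integrable_exp_mul_of_mem_Icc (hF.sub_const _).aemeasurable (ae_of_all _ this)
    · intro t
      exact integral_exp_pi_le μ F hF hc hab hb t
  exact h.measure_ge_le hr

end BoundedDifferences

/-! ### Symmetrization and uniform deviation. -/

section Symmetrization

open scoped BigOperators

variable {Z : Type*} {ι : Type*}

/-- The empirical Rademacher complexity of the family `φ` on the sample `S`. -/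
noncomputable def rademacherAvg {m : ℕ} (φ : ι → Z → ℝ) (S : Fin m → Z) : ℝ :=
  𝔼 ε : Fin m → ℤˣ, ⨆ i, 1 / (m : ℝ) * ∑ j, signVal (ε j) * φ i (S j)

/-- The largest difference between expectation and sample mean over the family `φ`. -/
noncomputable def supDeviation [MeasurableSpace Z] (μ : Measure Z) {m : ℕ} (φ : ι → Z → ℝ)
    (S : Fin m → Z) : ℝ :=
  ⨆ i, (∫ z, φ i z ∂μ - 1 / (m : ℝ) * ∑ j, φ i (S j))

lemma ciSup_mem_Icc [Nonempty ι] {f : ι → ℝ} {a b : ℝ} (h : ∀ i, f i ∈ Icc a b) :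
    ⨆ i, f i ∈ Icc a b := by
  have hb : BddAbove (range f) := ⟨b, by rintro _ ⟨i, rfl⟩; exact (h i).2⟩
  exact ⟨(h (Classical.arbitrary ι)).1.trans (le_ciSup hb _), ciSup_le fun i => (h i).2⟩

lemma ciSup_le_ciSup_add [Nonempty ι] {f g : ι → ℝ} {b c : ℝ} (hg : ∀ i, g i ≤ b)
    (h : ∀ i, f i ≤ g i + c) : ⨆ i, f i ≤ (⨆ i, g i) + c :=
  ciSup_le fun i => (h i).trans
    (add_le_add_left (le_ciSup ⟨b, by rintro _ ⟨i, rfl⟩; exact hg i⟩ i) c)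

lemma mean_mem_Icc {m : ℕ} (hm : 1 ≤ m) {f : Fin m → ℝ} {a b : ℝ} (h : ∀ j, f j ∈ Icc a b) :
    1 / (m : ℝ) * ∑ j, f j ∈ Icc a b := by
  have hm' : (0 : ℝ) < m := by exact_mod_cast hm
  have h1 : ∑ j : Fin m, a ≤ ∑ j, f j := Finset.sum_le_sum fun j _ => (h j).1
  have h2 : ∑ j, f j ≤ ∑ j : Fin m, b := Finset.sum_le_sum fun j _ => (h j).2
  simp only [Finset.sum_const, Finset.card_univ, Fintype.card_fin, nsmul_eq_mul] at h1 h2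
  rw [one_div, inv_mul_eq_div]
  exact ⟨by rw [le_div_iff₀ hm']; linarith, by rw [div_le_iff₀ hm']; linarith⟩

lemma expect_mem_Icc {κ : Type*} [Fintype κ] [Nonempty κ] {f : κ → ℝ} {a b : ℝ}
    (h : ∀ j, f j ∈ Icc a b) : 𝔼 j, f j ∈ Icc a b :=
  ⟨(Fintype.expect_const a).symm.le.trans (Finset.expect_le_expect fun j _ => (h j).1),
    (Finset.expect_le_expect fun j _ => (h j).2).trans (Fintype.expect_const b).le⟩

lemma sign_mul_mem_Icc (s : ℤˣ) {x M : ℝ} (hx : x ∈ Icc 0 M) : signVal s * x ∈ Icc (-M) M := by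
  rcases Int.units_eq_one_or s with rfl | rfl <;> simp only [signVal, mem_Icc] <;> constructor <;>
    push_cast <;> linarith [hx.1, hx.2]

lemma sum_update_sub {m : ℕ} (S : Fin m → Z) (i : Fin m) (z : Z) (f : Fin m → Z → ℝ) :
    ∑ j, f j (Function.update S i z j) = ∑ j, f j (S j) + (f i z - f i (S i)) := by
  have h : ∀ j, f j (Function.update S i z j) =
      f j (S j) + if j = i then f i z - f i (S i) else 0 := fun j => by
    by_cases hj : j = i
    · subst hj; simp
    · simp [hj]
  simp_rw [h, Finset.sum_add_distrib]
  simp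

variable {φ : ι → Z → ℝ} {M : ℝ}

lemma signed_mean_mem_Icc (hφ : ∀ i z, φ i z ∈ Icc 0 M) {m : ℕ} (hm : 1 ≤ m) (S : Fin m → Z)
    (ε : Fin m → ℤˣ) (i : ι) :
    1 / (m : ℝ) * ∑ j, signVal (ε j) * φ i (S j) ∈ Icc (-M) M :=
  mean_mem_Icc hm fun _ => sign_mul_mem_Icc _ (hφ i _)

lemma rademacherAvg_mem_Icc [Nonempty ι] (hφ : ∀ i z, φ i z ∈ Icc 0 M) {m : ℕ} (hm : 1 ≤ m) (S : Fin m → Z) :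
    rademacherAvg φ S ∈ Icc (-M) M :=
  expect_mem_Icc fun ε => ciSup_mem_Icc fun i => signed_mean_mem_Icc hφ hm S ε i

lemma rademacherAvg_update_le [Nonempty ι] (hφ : ∀ i z, φ i z ∈ Icc 0 M) {m : ℕ} (hm : 1 ≤ m) (S : Fin m → Z)
    (i : Fin m) (z : Z) :
    rademacherAvg φ (Function.update S i z) ≤ rademacherAvg φ S + M / m := by
  have hm' : (0 : ℝ) < m := by exact_mod_cast hm
  unfold rademacherAvg
  rw [← Fintype.expect_const (ι := Fin m → ℤˣ) (M / (m : ℝ)), ← Finset.expect_add_distrib]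
  refine Finset.expect_le_expect fun ε _ =>
    ciSup_le_ciSup_add (fun k => (signed_mean_mem_Icc hφ hm S ε k).2) fun k => ?_
  rw [sum_update_sub S i z fun j z => signVal (ε j) * φ k z, mul_add, one_div, div_eq_inv_mul]
  gcongr
  rw [← mul_sub]
  have h1 := hφ k z
  have h2 := hφ k (S i)
  rcases Int.units_eq_one_or (ε i) with h | h <;> rw [h] <;> simp only [signVal] <;> push_cast <;>
    linarith [h1.1, h1.2, h2.1, h2.2]

variable [MeasurableSpace Z] (μ : Measure Z)

lemma measurable_rademacherAvg [Countable ι] (hφm : ∀ i, Measurable (φ i)) (m : ℕ) :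
    Measurable fun S : Fin m → Z => rademacherAvg φ S := by
  unfold rademacherAvg
  simp_rw [Fintype.expect_eq_sum_div_card]
  refine (Finset.measurable_sum _ fun ε _ => Measurable.iSup fun i => ?_).div_const _
  exact (Finset.measurable_sum _ fun j _ =>
    ((hφm i).comp (measurable_pi_apply j)).const_mul _).const_mul _

lemma measurable_supDeviation [Countable ι] (hφm : ∀ i, Measurable (φ i)) (m : ℕ) :
    Measurable fun S : Fin m → Z => supDeviation μ φ S := by
  refine Measurable.iSup fun i => Measurable.const_sub ?_ _
  exact (Finset.measurable_sum _ fun j _ => (hφm i).comp (measurable_pi_apply j)).const_mul _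

variable [IsProbabilityMeasure μ]

lemma integral_mem_Icc {f : Z → ℝ} (hf : Measurable f) {a b : ℝ} (h : ∀ z, f z ∈ Icc a b) :
    ∫ z, f z ∂μ ∈ Icc a b := by
  have hi : Integrable f μ := Integrable.of_mem_Icc a b hf.aemeasurable (ae_of_all _ h)
  constructor
  · simpa using integral_mono (integrable_const a) hi fun z => (h z).1
  · simpa using integral_mono hi (integrable_const b) fun z => (h z).2

lemma deviation_mem_Icc (hφm : ∀ i, Measurable (φ i)) (hφ : ∀ i z, φ i z ∈ Icc 0 M) {m : ℕ}
    (hm : 1 ≤ m) (S : Fin m → Z) (i : ι) :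
    ∫ z, φ i z ∂μ - 1 / (m : ℝ) * ∑ j, φ i (S j) ∈ Icc (-M) M := by
  have h1 := integral_mem_Icc μ (hφm i) (hφ i)
  have h2 := mean_mem_Icc hm fun j => hφ i (S j)
  exact ⟨by linarith [h1.1, h2.2], by linarith [h1.2, h2.1]⟩

lemma supDeviation_mem_Icc [Nonempty ι] (hφm : ∀ i, Measurable (φ i)) (hφ : ∀ i z, φ i z ∈ Icc 0 M) {m : ℕ}
    (hm : 1 ≤ m) (S : Fin m → Z) : supDeviation μ φ S ∈ Icc (-M) M :=
  ciSup_mem_Icc (deviation_mem_Icc μ hφm hφ hm S)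

lemma supDeviation_le_update [Nonempty ι] (hφm : ∀ i, Measurable (φ i)) (hφ : ∀ i z, φ i z ∈ Icc 0 M) {m : ℕ}
    (hm : 1 ≤ m) (S : Fin m → Z) (i : Fin m) (z : Z) :
    supDeviation μ φ S ≤ supDeviation μ φ (Function.update S i z) + M / m := by
  have hm' : (0 : ℝ) < m := by exact_mod_cast hm
  refine ciSup_le_ciSup_add (fun k => (deviation_mem_Icc μ hφm hφ hm _ k).2) fun k => ?_
  rw [sum_update_sub S i z fun _ z => φ k z, mul_add, one_div, div_eq_inv_mul]
  have : (m : ℝ)⁻¹ * (φ k z - φ k (S i)) ≤ (m : ℝ)⁻¹ * M := by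
    gcongr
    linarith [(hφ k z).2, (hφ k (S i)).1]
  linarith

/-- The sign vector `ε` acts on pairs of samples by swapping the points with negative sign. -/
def swapBySign {m : ℕ} (ε : Fin m → ℤˣ) (q : Fin m → Z × Z) : Fin m → Z × Z :=
  fun j => if ε j = 1 then q j else (q j).swap

lemma measurePreserving_swapBySign {m : ℕ} (ε : Fin m → ℤˣ) :
    MeasurePreserving (swapBySign (Z := Z) ε) (Measure.pi fun _ => μ.prod μ)
      (Measure.pi fun _ => μ.prod μ) := by
  refine measurePreserving_pi (f := fun j (r : Z × Z) => if ε j = 1 then r else r.swap) _ _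
    fun j => ?_
  by_cases h : ε j = 1
  · simp only [h, if_true]
    exact MeasurePreserving.id (μ.prod μ)
  · simpa [h] using Measure.measurePreserving_swap (μ := μ) (ν := μ)

/-- The expectation is the average over a ghost sample, and a supremum of integrals is at most the
integral of the supremum. -/
lemma supDeviation_le_integral [Nonempty ι] [Countable ι] (hφm : ∀ i, Measurable (φ i)) (hφ : ∀ i z, φ i z ∈ Icc 0 M)
    {m : ℕ} (hm : 1 ≤ m) (S : Fin m → Z) :
    supDeviation μ φ S ≤ ∫ S', ⨆ i, 1 / (m : ℝ) * ∑ j, (φ i (S' j) - φ i (S j))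
      ∂(Measure.pi fun _ => μ) := by
  have hm' : (m : ℝ) ≠ 0 := by positivity
  have hev : ∀ i (j : Fin m), Integrable (fun S' : Fin m → Z => φ i (S' j))
      (Measure.pi fun _ => μ) := fun i j =>
    Integrable.of_mem_Icc 0 M ((hφm i).comp (measurable_pi_apply j)).aemeasurable
      (ae_of_all _ fun _ => hφ i _)
  have hevI : ∀ i (j : Fin m), ∫ S' : Fin m → Z, φ i (S' j) ∂(Measure.pi fun _ => μ) =
      ∫ z, φ i z ∂μ := fun i j => by
    have := measurePreserving_eval (fun _ : Fin m => μ) j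
    conv_rhs => rw [← this.map_eq]
    rw [integral_map this.measurable.aemeasurable (hφm i).aestronglyMeasurable]
  have hmem : ∀ (S' : Fin m → Z) i, 1 / (m : ℝ) * ∑ j, (φ i (S' j) - φ i (S j)) ∈ Icc (-M) M := fun S' i =>
    mean_mem_Icc hm fun j => ⟨by linarith [(hφ i (S' j)).1, (hφ i (S j)).2],
      by linarith [(hφ i (S' j)).2, (hφ i (S j)).1]⟩
  refine ciSup_le fun i => ?_
  calc _ = ∫ S', 1 / (m : ℝ) * ∑ j, (φ i (S' j) - φ i (S j)) ∂(Measure.pi fun _ => μ) := by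
        have hsum : ∫ S' : Fin m → Z, ∑ j, (φ i (S' j) - φ i (S j)) ∂(Measure.pi fun _ => μ) =
            ∑ j : Fin m, (∫ z, φ i z ∂μ - φ i (S j)) := by
          rw [integral_finsetSum Finset.univ (f := fun j (S' : Fin m → Z) => φ i (S' j) - φ i (S j))
            fun j _ => (hev i j).sub (integrable_const _)]
          refine Finset.sum_congr rfl fun j _ => ?_
          rw [integral_sub (hev i j) (integrable_const _), hevI]
          simp
        rw [integral_const_mul, hsum]
        simp [mul_sub, hm']
    _ ≤ _ := by
        refine integral_mono ?_ ?_ fun S' => ?_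
        · exact (integrable_finsetSum _ fun j _ => (hev i j).sub (integrable_const _)).const_mul _
        · refine Integrable.of_mem_Icc (-M) M ?_ (ae_of_all _ fun S' => ciSup_mem_Icc (hmem S'))
          refine (Measurable.iSup fun i => ?_).aemeasurable
          exact (Finset.measurable_sum _ fun j _ =>
            ((hφm i).comp (measurable_pi_apply j)).sub_const _).const_mul _
        · exact le_ciSup (f := fun i => 1 / (m : ℝ) * ∑ j, (φ i (S' j) - φ i (S j)))
            ⟨M, by rintro _ ⟨i, rfl⟩; exact (hmem S' i).2⟩ i

/-- Symmetrization. -/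
lemma integral_supDeviation_le [Nonempty ι] [Countable ι] (hφm : ∀ i, Measurable (φ i)) (hφ : ∀ i z, φ i z ∈ Icc 0 M)
    {m : ℕ} (hm : 1 ≤ m) :
    ∫ S : Fin m → Z, supDeviation μ φ S ∂(Measure.pi fun _ => μ) ≤
      2 * ∫ S : Fin m → Z, rademacherAvg φ S ∂(Measure.pi fun _ => μ) := by
  set ν := Measure.pi fun _ : Fin m => μ
  set ν₂ := Measure.pi fun _ : Fin m => μ.prod μ
  set W : (Fin m → ℤˣ) → (Fin m → Z × Z) → ℝ := fun ε q =>
    ⨆ i, 1 / (m : ℝ) * ∑ j, signVal (ε j) * (φ i (q j).2 - φ i (q j).1) with hW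
  set U : (Fin m → ℤˣ) → (Fin m → Z) → ℝ := fun ε S =>
    ⨆ i, 1 / (m : ℝ) * ∑ j, signVal (ε j) * φ i (S j) with hU
  have hWm : ∀ ε, Measurable (W ε) := fun ε => by
    refine Measurable.iSup fun i => (Finset.measurable_sum _ fun j _ => ?_).const_mul _
    exact (((hφm i).comp (measurable_snd.comp (measurable_pi_apply j))).sub
      ((hφm i).comp (measurable_fst.comp (measurable_pi_apply j)))).const_mul _
  have hWmem : ∀ (ε : Fin m → ℤˣ) (q : Fin m → Z × Z) i, 1 / (m : ℝ) * ∑ j, signVal (ε j) * (φ i (q j).2 - φ i (q j).1) ∈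
      Icc (-M) M := fun ε q i => mean_mem_Icc hm fun j => by
    have h1 := hφ i (q j).1
    have h2 := hφ i (q j).2
    rcases Int.units_eq_one_or (ε j) with h | h <;> rw [h] <;> simp only [signVal, mem_Icc] <;>
      constructor <;> push_cast <;> linarith [h1.1, h1.2, h2.1, h2.2]
  have hWint : ∀ ε, Integrable (W ε) ν₂ := fun ε => Integrable.of_mem_Icc (-M) M
    (hWm ε).aemeasurable (ae_of_all _ fun q => ciSup_mem_Icc (hWmem ε q))
  have hUm : ∀ ε, Measurable (U ε) := fun ε => by
    refine Measurable.iSup fun i => (Finset.measurable_sum _ fun j _ => ?_).const_mul _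
    exact ((hφm i).comp (measurable_pi_apply j)).const_mul _
  have hUint : ∀ ε, Integrable (U ε) ν := fun ε => Integrable.of_mem_Icc (-M) M
    (hUm ε).aemeasurable (ae_of_all _ fun S => ciSup_mem_Icc (signed_mean_mem_Icc hφ hm S ε))
  -- Swapping the pairs with negative sign preserves the law and multiplies each difference by its
  -- sign.
  have hswap : ∀ ε, ∫ q, W 1 q ∂ν₂ = ∫ q, W ε q ∂ν₂ := fun ε => by
    have h := measurePreserving_swapBySign (m := m) μ ε
    conv_lhs => rw [show ν₂ = Measure.map (swapBySign ε) ν₂ from h.map_eq.symm]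
    rw [integral_map h.measurable.aemeasurable (hWm 1).aestronglyMeasurable]
    refine integral_congr_ae (ae_of_all _ fun q => ?_)
    simp only [hW]
    congr 1; ext i; congr 1
    refine Finset.sum_congr rfl fun j _ => ?_
    rcases Int.units_eq_one_or (ε j) with h | h <;> simp [swapBySign, h, signVal]
  have hfst : MeasurePreserving (fun (q : Fin m → Z × Z) j => (q j).1) ν₂ ν :=
    measurePreserving_pi _ _ fun _ => measurePreserving_fst
  have hsnd : MeasurePreserving (fun (q : Fin m → Z × Z) j => (q j).2) ν₂ ν :=
    measurePreserving_pi _ _ fun _ => measurePreserving_snd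
  have hfstI : ∀ ε, ∫ q : Fin m → Z × Z, U ε (fun j => (q j).1) ∂ν₂ = ∫ S, U ε S ∂ν := fun ε => by
    rw [← hfst.map_eq, integral_map hfst.measurable.aemeasurable (hUm ε).aestronglyMeasurable]
  have hsndI : ∀ ε, ∫ q : Fin m → Z × Z, U ε (fun j => (q j).2) ∂ν₂ = ∫ S, U ε S ∂ν := fun ε => by
    rw [← hsnd.map_eq, integral_map hsnd.measurable.aemeasurable (hUm ε).aestronglyMeasurable]
  -- The differences split over the two samples; both parts have the same mean over `ε`, whence the
  -- factor 2.
  have hWU : ∀ ε, ∫ q, W ε q ∂ν₂ ≤ ∫ S, U ε S ∂ν + ∫ S, U (-ε) S ∂ν := fun ε => by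
    have hi1 : Integrable (fun q : Fin m → Z × Z => U ε (fun j => (q j).2)) ν₂ :=
      hsnd.integrable_comp_of_integrable (hUint ε)
    have hi2 : Integrable (fun q : Fin m → Z × Z => U (-ε) (fun j => (q j).1)) ν₂ :=
      hfst.integrable_comp_of_integrable (hUint (-ε))
    rw [← hsndI ε, ← hfstI (-ε), ← integral_add hi1 hi2]
    refine integral_mono (hWint ε) (hi1.add hi2) fun q => ciSup_le fun i => ?_
    have hb : ∀ ε (S : Fin m → Z), 1 / (m : ℝ) * ∑ j, signVal (ε j) * φ i (S j) ≤ U ε S :=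
      fun ε S => le_ciSup (f := fun i => 1 / (m : ℝ) * ∑ j, signVal (ε j) * φ i (S j))
        ⟨M, by rintro _ ⟨i, rfl⟩; exact (signed_mean_mem_Icc hφ hm S ε i).2⟩ i
    have h1 := hb ε fun j => (q j).2
    have h2 := hb (-ε) fun j => (q j).1
    refine le_trans (le_of_eq ?_) (add_le_add h1 h2)
    rw [← mul_add, ← Finset.sum_add_distrib]
    congr 1
    refine Finset.sum_congr rfl fun j _ => ?_
    simp [signVal]
    ring
  have hrad : ∫ S, rademacherAvg φ S ∂ν = 𝔼 ε : Fin m → ℤˣ, ∫ S, U ε S ∂ν := by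
    unfold rademacherAvg
    simp_rw [Fintype.expect_eq_sum_div_card]
    rw [integral_div, integral_finsetSum _ fun ε _ => hUint ε]
  have hneg : 𝔼 ε : Fin m → ℤˣ, ∫ S, U (-ε) S ∂ν = 𝔼 ε : Fin m → ℤˣ, ∫ S, U ε S ∂ν :=
    Fintype.expect_equiv (Equiv.neg _) _ _ fun ε => rfl
  have hmp := measurePreserving_arrowProdEquivProdArrow Z Z (Fin m) (fun _ => μ) (fun _ => μ)
  set K : (Fin m → Z) × (Fin m → Z) → ℝ := fun q =>
    ⨆ i, 1 / (m : ℝ) * ∑ j, (φ i (q.2 j) - φ i (q.1 j)) with hK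
  have hKW : (fun q => K (MeasurableEquiv.arrowProdEquivProdArrow Z Z (Fin m) q)) = W 1 := by
    ext q
    simp [hK, hW, signVal, MeasurableEquiv.arrowProdEquivProdArrow, Equiv.arrowProdEquivProdArrow]
  have hKint : Integrable K (ν.prod ν) := by
    rw [← hmp.integrable_comp_emb (MeasurableEquiv.measurableEmbedding _)]
    have := hWint 1
    rw [← hKW] at this
    exact this
  calc ∫ S, supDeviation μ φ S ∂ν ≤ ∫ S, ∫ S', K (S, S') ∂ν ∂ν := by
        refine integral_mono ?_ hKint.integral_prod_left fun S => ?_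
        · exact Integrable.of_mem_Icc (-M) M (measurable_supDeviation μ hφm m).aemeasurable
            (ae_of_all _ fun S => supDeviation_mem_Icc μ hφm hφ hm S)
        · exact supDeviation_le_integral μ hφm hφ hm S
    _ = ∫ q, W 1 q ∂ν₂ := by
        rw [← integral_prod _ hKint, ← hKW,
          hmp.integral_comp (MeasurableEquiv.measurableEmbedding _)]
    _ = 𝔼 ε : Fin m → ℤˣ, ∫ q, W ε q ∂ν₂ := by
        simp_rw [← hswap]
        rw [Fintype.expect_const]
    _ ≤ 𝔼 ε : Fin m → ℤˣ, (∫ S, U ε S ∂ν + ∫ S, U (-ε) S ∂ν) :=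
        Finset.expect_le_expect fun ε _ => hWU ε
    _ = _ := by
        rw [Finset.expect_add_distrib, hneg, hrad]
        ring

/-- The uniform deviation bound for a countable family with values in `[0, M]`, with the empirical
Rademacher complexity. -/
theorem exists_uniform_deviation_event [Nonempty ι] [Countable ι] (hφm : ∀ i, Measurable (φ i))
    (hφ : ∀ i z, φ i z ∈ Icc 0 M) {m : ℕ} (hm : 1 ≤ m) (hM : 0 < M) {r : ℝ} (hr : 0 ≤ r) :
    ∃ A : Set (Fin m → Z), MeasurableSet A ∧
      (Measure.pi fun _ : Fin m => μ).real Aᶜ ≤ Real.exp (-r) ∧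
      ∀ S ∈ A, ∀ i, ∫ z, φ i z ∂μ ≤ 1 / (m : ℝ) * ∑ j, φ i (S j) + 2 * rademacherAvg φ S +
        3 * M * √(r / (2 * m)) := by
  have hm' : (0 : ℝ) < m := by exact_mod_cast hm
  set ν := Measure.pi fun _ : Fin m => μ
  -- Subtracting the empirical average inside `F` avoids a second concentration step: replacing one
  -- point changes the two parts by at most `M/m` and `2M/m`.
  set F : (Fin m → Z) → ℝ := fun S => supDeviation μ φ S - 2 * rademacherAvg φ S with hF
  have hd := measurable_supDeviation μ hφm m
  have hR := measurable_rademacherAvg hφm m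
  have hFm : Measurable F := hd.sub (hR.const_mul 2)
  have hdmem := fun S : Fin m → Z => supDeviation_mem_Icc μ hφm hφ hm S
  have hRmem := fun S : Fin m → Z => rademacherAvg_mem_Icc hφ hm S
  have hFmem : ∀ S, F S ∈ Icc (-(3 * M)) (3 * M) := fun S =>
    ⟨by linarith [(hdmem S).1, (hRmem S).2], by linarith [(hdmem S).2, (hRmem S).1]⟩
  have hFb : ∀ S i z, F S - F (Function.update S i z) ≤ 3 * M / m := fun S i z => by
    have h1 := supDeviation_le_update μ hφm hφ hm S i z
    have h2 := rademacherAvg_update_le hφ hm S i z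
    have h3 : 3 * M / m = M / m + 2 * (M / m) := by ring
    linarith
  have hEF : ∫ S, F S ∂ν ≤ 0 := by
    have h1 : Integrable (fun S => supDeviation μ φ S) ν :=
      Integrable.of_mem_Icc _ _ hd.aemeasurable (ae_of_all _ hdmem)
    have h2 : Integrable (fun S => rademacherAvg φ S) ν :=
      Integrable.of_mem_Icc _ _ hR.aemeasurable (ae_of_all _ hRmem)
    rw [integral_sub h1 (h2.const_mul 2), integral_const_mul]
    linarith [integral_supDeviation_le μ hφm hφ hm]
  refine ⟨{S | 3 * M * √(r / (2 * m)) ≤ F S - ∫ S, F S ∂ν}ᶜ,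
    (measurableSet_le measurable_const (hFm.sub_const _)).compl, ?_, fun S hS i => ?_⟩
  · rw [compl_compl]
    refine (measureReal_pi_le_exp_of_bounded_differences μ F hFm (by positivity) hFmem hFb
      (by positivity)).trans (le_of_eq ?_)
    rw [mul_pow, Real.sq_sqrt (by positivity)]
    congr 1
    field_simp
  · simp only [mem_compl_iff, mem_ofPred_eq, not_le] at hS
    have : ∫ z, φ i z ∂μ - 1 / (m : ℝ) * ∑ j, φ i (S j) ≤ supDeviation μ φ S :=
      le_ciSup (f := fun i => ∫ z, φ i z ∂μ - 1 / (m : ℝ) * ∑ j, φ i (S j))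
        ⟨M, by rintro _ ⟨i, rfl⟩; exact (deviation_mem_Icc μ hφm hφ hm S i).2⟩ i
    linarith

end Symmetrization

/-! ### Margin losses as Lipschitz functions of the score vector. -/

section MarginLoss

lemma truncate_mem_Icc {M : ℝ} (hM : 0 ≤ M) (r : ℝ) : truncate M r ∈ Icc 0 M :=
  ⟨le_min hM (le_max_left _ _), min_le_left _ _⟩

lemma truncate_le_truncate_add {M r s d : ℝ} (hd : 0 ≤ d) (h : r ≤ s + d) :
    truncate M r ≤ truncate M s + d := by
  unfold truncate
  rw [min_add]
  refine min_le_min (by linarith) ?_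
  rw [max_add]
  exact max_le_max (by linarith) h

variable {Y : Type u}

/-- The margin loss with the offsets `a` and the weights `b`, as a function of the vector `u` of
the scores of all outputs. -/
noncomputable def marginLoss (M : ℝ) (a b : Y → Y → ℝ) (ρ τ : ℝ) (u : Y → ℝ) (y : Y) : ℝ :=
  truncate M (⨆ y' : {y' : Y // y' ≠ y}, (a y' y + b y' y * (τ - 1 / ρ * (u y - u y'))))

lemma addLoss_eq_marginLoss {X : Type w} (L : Y → Y → ℝ) (ρ τ : ℝ) (h : X → Y → ℝ) (x : X) (y : Y) :
    addLoss L ρ τ h x y = marginLoss (lossMax L) L 1 ρ τ (h x) y := by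
  simp [addLoss, marginLoss, add_sub_assoc]

/-- Since `L (1 + s) = L + L s`, offset and weight are both `L`, against weight 1 in the additive
case. One template serves both bounds. -/
lemma multLoss_eq_marginLoss {X : Type w} (L : Y → Y → ℝ) (ρ τ : ℝ) (h : X → Y → ℝ) (x : X)
    (y : Y) : multLoss L ρ τ h x y = marginLoss (lossMax L) L L ρ τ (h x) y := by
  unfold multLoss marginLoss
  congr 2
  ext y'
  ring

variable [Finite Y] {M ρ τ B : ℝ} {a b : Y → Y → ℝ}

lemma le_lossMax (L : Y → Y → ℝ) (y y' : Y) : L y y' ≤ lossMax L :=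
  le_ciSup (f := fun p : Y × Y => L p.1 p.2) (finite_range _).bddAbove (y, y')

lemma marginLoss_le_add {τ' d : ℝ} {u w : Y → ℝ} {y : Y} (hd : 0 ≤ d)
    (h : ∀ y', y' ≠ y → b y' y * (τ - 1 / ρ * (u y - u y')) ≤
      b y' y * (τ' - 1 / ρ * (w y - w y')) + d) :
    marginLoss M a b ρ τ u y ≤ marginLoss M a b ρ τ' w y + d := by
  refine truncate_le_truncate_add hd ?_
  -- With a single output there is no competitor, and both suprema take the default value 0.
  rcases isEmpty_or_nonempty {y' : Y // y' ≠ y} with hE | hE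
  · simpa [Real.iSup_of_isEmpty] using hd
  · refine ciSup_le fun y' => ?_
    have := le_ciSup (f := fun y' : {y' : Y // y' ≠ y} =>
      a y' y + b y' y * (τ' - 1 / ρ * (w y - w y'))) (finite_range _).bddAbove y'
    linarith [h y' y'.2]

lemma le_marginLoss {u : Y → ℝ} {y y' : Y} (hne : y' ≠ y) (hM : a y' y ≤ M)
    (h : 0 ≤ b y' y * (τ - 1 / ρ * (u y - u y'))) : a y' y ≤ marginLoss M a b ρ τ u y := by
  refine le_min hM (le_max_of_le_right ?_)
  have := le_ciSup (f := fun y' : {y' : Y // y' ≠ y} =>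
      a y' y + b y' y * (τ - 1 / ρ * (u y - u y'))) (finite_range _).bddAbove ⟨y', hne⟩
  simp only at this
  linarith

/-- The margin loss is Lipschitz in the differences of the scores. -/
lemma marginLoss_le_add_of_forall_abs_le (hρ : 0 < ρ) (hb0 : ∀ y y', 0 ≤ b y y')
    (hbB : ∀ y y', b y y' ≤ B) {u w : Y → ℝ} {y : Y} {e : ℝ} (he : 0 ≤ e)
    (h : ∀ y', y' ≠ y → |(u y - w y) - (u y' - w y')| ≤ e) :
    marginLoss M a b ρ τ u y ≤ marginLoss M a b ρ τ w y + B / ρ * e := by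
  have hB : 0 ≤ B := (hb0 y y).trans (hbB y y)
  refine marginLoss_le_add (by positivity) fun y' hy' => ?_
  have h1 := (abs_le.1 (h y' hy')).1
  have h2 : b y' y * (1 / ρ * -((u y - w y) - (u y' - w y'))) ≤ B * (1 / ρ * e) := by
    calc _ ≤ b y' y * (1 / ρ * e) := by
          refine mul_le_mul_of_nonneg_left ?_ (hb0 _ _)
          refine mul_le_mul_of_nonneg_left (by linarith) (by positivity)
      _ ≤ _ := mul_le_mul_of_nonneg_right (hbB _ _) (by positivity)
  have h3 : B / ρ * e = B * (1 / ρ * e) := by ring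
  rw [h3]
  linarith

/-- Used twice: for measurability of the loss, and to pass to pointwise limits of scores. -/
lemma continuous_marginLoss (hρ : 0 < ρ) (hb0 : ∀ y y', 0 ≤ b y y')
    (hbB : ∀ y y', b y y' ≤ B) (y : Y) :
    Continuous fun u : Y → ℝ => marginLoss M a b ρ τ u y := by
  have := Fintype.ofFinite Y
  have hB : 0 ≤ B := (hb0 y y).trans (hbB y y)
  have key : ∀ u w : Y → ℝ, marginLoss M a b ρ τ u y ≤ marginLoss M a b ρ τ w y +
      B / ρ * (2 * dist u w) := fun u w => by
    refine marginLoss_le_add_of_forall_abs_le hρ hb0 hbB (by positivity) fun y' _ => ?_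
    have h1 := dist_le_pi_dist u w y
    have h2 := dist_le_pi_dist u w y'
    rw [Real.dist_eq] at h1 h2
    exact (abs_sub _ _).trans (by linarith)
  rw [continuous_iff_continuousAt]
  intro w
  rw [ContinuousAt, tendsto_iff_dist_tendsto_zero]
  refine squeeze_zero (fun _ => dist_nonneg) (g := fun u => B / ρ * (2 * dist u w)) (fun u => ?_) ?_
  · rw [Real.dist_eq, abs_le]
    have h1 := key u w
    have h2 := key w u
    rw [dist_comm w u] at h2
    exact ⟨by linarith, by linarith⟩
  · exact Continuous.tendsto' (by fun_prop) _ _ (by simp)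

end MarginLoss

/-! ### Random averages drawn with the weights of the ensemble. -/

section Sampling

variable {T : ℕ} {α : Fin T → ℝ}

lemma sum_prod_eq_one (hα : α ∈ stdSimplex ℝ (Fin T)) (n : ℕ) :
    ∑ t : Fin n → Fin T, ∏ j, α (t j) = 1 := by
  rw [← Fintype.sum_pow, hα.2, one_pow]

lemma sum_prod_mul_sum (hα : α ∈ stdSimplex ℝ (Fin T)) (n : ℕ) (f : Fin T → ℝ) :
    ∑ t : Fin n → Fin T, (∏ j, α (t j)) * ∑ j, f (t j) = n * ∑ s, α s * f s := by
  have h : ∀ l : Fin n, ∑ t : Fin n → Fin T, (∏ j, α (t j)) * f (t l) = ∑ s, α s * f s := by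
    intro l
    have h1 : ∀ t : Fin n → Fin T, (∏ j, α (t j)) * f (t l) =
        ∏ j, (α (t j) * if j = l then f (t j) else 1) := fun t => by
      rw [Finset.prod_mul_distrib]
      simp
    simp_rw [h1]
    have h2 := Finset.prod_univ_sum (fun _ : Fin n => (Finset.univ : Finset (Fin T)))
      fun j s => α s * if j = l then f s else 1
    rw [Fintype.piFinset_univ] at h2
    rw [← h2, Finset.prod_eq_single l]
    · simp
    · intro j _ hj
      simp [hj, hα.2]
    · simp
  simp_rw [Finset.mul_sum]
  rw [Finset.sum_comm]
  simp [h, Finset.mul_sum]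

/-- The weights are read as a discrete probability measure, so that Hoeffding's lemma applies with
oscillation 2. -/
lemma sum_mul_exp_le (hα : α ∈ stdSimplex ℝ (Fin T)) (c : Fin T → ℝ) (hc : ∀ s, c s ∈ Icc (-1) 1)
    (l : ℝ) : ∑ s, α s * Real.exp (l * (c s - ∑ s, α s * c s)) ≤ Real.exp (l ^ 2 / 2) := by
  set μ : Measure (Fin T) := ∑ s, ENNReal.ofReal (α s) • Measure.dirac s with hμ
  have hint : ∀ f : Fin T → ℝ, ∫ s, f s ∂μ = ∑ s, α s * f s := fun f => by
    rw [hμ, integral_finsetSum_measure fun s _ => (integrable_dirac (by simp)).smul_measure (by simp)]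
    refine Finset.sum_congr rfl fun s _ => ?_
    rw [integral_smul_measure, integral_dirac, ENNReal.toReal_ofReal (hα.1 s), smul_eq_mul]
  have : IsProbabilityMeasure μ := ⟨by
    simp only [hμ, Measure.coe_finsetSum, Finset.sum_apply, Measure.smul_apply, measure_univ,
      smul_eq_mul, mul_one]
    rw [← ENNReal.ofReal_sum_of_nonneg fun s _ => hα.1 s, hα.2, ENNReal.ofReal_one]⟩
  have := integral_exp_sub_integral_le μ (X := c) (measurable_of_finite c) (c := 2) (by norm_num) hc
    (fun z z' => by linarith [(hc z).2, (hc z').1]) l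
  rw [hint, hint] at this
  simpa using this

/-- Hoeffding's inequality for the mean of `n` independent draws from the weights `α`. -/
lemma sum_prod_mul_indicator_le (hα : α ∈ stdSimplex ℝ (Fin T)) (c : Fin T → ℝ)
    (hc : ∀ s, c s ∈ Icc (-1) 1) {n : ℕ} (hn : 1 ≤ n) {ρ : ℝ} (hρ : 0 < ρ) :
    ∑ t : Fin n → Fin T, (∏ j, α (t j)) *
      (if ρ / 2 < 1 / (n : ℝ) * ∑ j, c (t j) - ∑ s, α s * c s then (1 : ℝ) else 0) ≤
      Real.exp (-(n * ρ ^ 2 / 8)) := by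
  have hn' : (0 : ℝ) < n := by exact_mod_cast hn
  set m := ∑ s, α s * c s with hm
  -- Chernoff bound with parameter `ρ/2`, the minimizer of `n (l²/2 - l ρ/2)` over `l`.
  calc _ ≤ ∑ t : Fin n → Fin T, (∏ j, α (t j)) *
        (Real.exp (-(n * ρ ^ 2 / 4)) * ∏ j, Real.exp (ρ / 2 * (c (t j) - m))) := by
        refine Finset.sum_le_sum fun t _ =>
          mul_le_mul_of_nonneg_left ?_ (Finset.prod_nonneg fun j _ => hα.1 _)
        rw [← Real.exp_sum, ← Real.exp_add]
        split_ifs with h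
        · rw [← Real.exp_zero]
          refine Real.exp_le_exp.2 ?_
          rw [← Finset.mul_sum, Finset.sum_sub_distrib]
          simp only [Finset.sum_const, Finset.card_univ, Fintype.card_fin, nsmul_eq_mul]
          have h1 : n * (ρ / 2) < n * (1 / (n : ℝ) * ∑ j, c (t j) - m) :=
            mul_lt_mul_of_pos_left h hn'
          have h2 : n * (1 / (n : ℝ) * ∑ j, c (t j) - m) = ∑ j, c (t j) - n * m := by
            field_simp
          have h3 : ρ / 2 * (n * (ρ / 2)) ≤ ρ / 2 * (∑ j, c (t j) - n * m) :=
            mul_le_mul_of_nonneg_left (by linarith) (by positivity)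
          linarith
        · exact (Real.exp_pos _).le
    _ = Real.exp (-(n * ρ ^ 2 / 4)) * (∑ s, α s * Real.exp (ρ / 2 * (c s - m))) ^ n := by
        rw [Fintype.sum_pow, Finset.mul_sum]
        refine Finset.sum_congr rfl fun t _ => ?_
        rw [Finset.prod_mul_distrib]
        ring
    _ ≤ Real.exp (-(n * ρ ^ 2 / 4)) * (Real.exp ((ρ / 2) ^ 2 / 2)) ^ n := by
        refine mul_le_mul_of_nonneg_left (pow_le_pow_left₀ ?_ (sum_mul_exp_le hα c hc _) n)
          (Real.exp_pos _).le
        exact Finset.sum_nonneg fun s _ => mul_nonneg (hα.1 s) (Real.exp_pos _).le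
    _ = _ := by
        rw [← Real.exp_nat_mul, ← Real.exp_add]
        congr 1
        ring

variable {Y : Type u} {M ρ : ℝ} {a b : Y → Y → ℝ}

/-- The mean over the draws `t` of the score vectors `u`. -/
noncomputable def drawMean {n : ℕ} (u : Fin T → Y → ℝ) (t : Fin n → Fin T) (y : Y) : ℝ :=
  1 / (n : ℝ) * ∑ j, u (t j) y

lemma sum_prod_mul_indicator_drawMean_le (hα : α ∈ stdSimplex ℝ (Fin T)) {n : ℕ} (hn : 1 ≤ n)
    (hρ : 0 < ρ) {u : Fin T → Y → ℝ} (hu : ∀ s y, u s y ∈ Icc (0 : ℝ) 1) (y y' : Y) :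
    ∑ t : Fin n → Fin T, (∏ j, α (t j)) *
      (if ρ / 2 < (drawMean u t y - drawMean u t y') - (∑ s, α s * u s y - ∑ s, α s * u s y')
        then (1 : ℝ) else 0) ≤ Real.exp (-(n * ρ ^ 2 / 8)) := by
  have := sum_prod_mul_indicator_le hα (fun s => u s y - u s y')
    (fun s => ⟨by linarith [(hu s y).1, (hu s y').2], by linarith [(hu s y).2, (hu s y').1]⟩) hn hρ
  refine le_trans (le_of_eq (Finset.sum_congr rfl fun t _ => ?_)) this
  congr 2
  simp only [drawMean, mul_sub, Finset.sum_sub_distrib]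

variable [Fintype Y]

/-- Only the competitor `y'` matters here: unless its score difference strays by more than `ρ/2`,
its margin term stays nonnegative and the loss is at least `a y' y`. Hence one copy of the error `M
e` and no union bound. -/
lemma le_sum_prod_mul_marginLoss (hα : α ∈ stdSimplex ℝ (Fin T)) {n : ℕ} (hn : 1 ≤ n)
    (hρ : 0 < ρ) {u : Fin T → Y → ℝ} (hu : ∀ s y, u s y ∈ Icc (0 : ℝ) 1)
    (hM : 0 ≤ M) (haM : ∀ y y', a y y' ≤ M) (ha : ∀ y, a y y = 0) (hb0 : ∀ y y', 0 ≤ b y y')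
    {y y' : Y} (hy' : ∑ s, α s * u s y ≤ ∑ s, α s * u s y') :
    a y' y ≤ ∑ t : Fin n → Fin T, (∏ j, α (t j)) * marginLoss M a b ρ (1 / 2) (drawMean u t) y +
      M * Real.exp (-(n * ρ ^ 2 / 8)) := by
  set bad : (Fin n → Fin T) → ℝ := fun t =>
    if ρ / 2 < (drawMean u t y - drawMean u t y') - (∑ s, α s * u s y - ∑ s, α s * u s y')
      then (1 : ℝ) else 0 with hbad
  have hpt : ∀ t : Fin n → Fin T,
      a y' y ≤ marginLoss M a b ρ (1 / 2) (drawMean u t) y + M * bad t := fun t => by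
    have h0 := (truncate_mem_Icc hM (⨆ y' : {y' : Y // y' ≠ y},
      (a y' y + b y' y * (1 / 2 - 1 / ρ * (drawMean u t y - drawMean u t y'))))).1
    change 0 ≤ marginLoss M a b ρ (1 / 2) (drawMean u t) y at h0
    have hb : 0 ≤ bad t := by rw [hbad]; simp only; split_ifs <;> norm_num
    by_cases hne : y' = y
    · rw [hne, ha]; positivity
    · by_cases h : ρ / 2 < (drawMean u t y - drawMean u t y') -
          (∑ s, α s * u s y - ∑ s, α s * u s y')
      · rw [hbad]; simp only [h, if_true]
        linarith [haM y' y]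
      · have := le_marginLoss (a := a) (b := b) (M := M) (ρ := ρ) (τ := 1 / 2)
          (u := drawMean u t) hne (haM _ _) (by
            refine mul_nonneg (hb0 _ _) ?_
            have h1 : 1 / ρ * (drawMean u t y - drawMean u t y') ≤ 1 / ρ * (ρ / 2) :=
              mul_le_mul_of_nonneg_left (by linarith) (by positivity)
            have h2 : 1 / ρ * (ρ / 2) = 1 / 2 := by field_simp
            linarith)
        have : 0 ≤ M * bad t := mul_nonneg hM hb
        linarith
  calc a y' y = ∑ t : Fin n → Fin T, (∏ j, α (t j)) * a y' y := by
        rw [← Finset.sum_mul, sum_prod_eq_one hα, one_mul]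
    _ ≤ ∑ t : Fin n → Fin T, (∏ j, α (t j)) *
          (marginLoss M a b ρ (1 / 2) (drawMean u t) y + M * bad t) :=
        Finset.sum_le_sum fun t _ =>
          mul_le_mul_of_nonneg_left (hpt t) (Finset.prod_nonneg fun j _ => hα.1 _)
    _ = ∑ t : Fin n → Fin T, (∏ j, α (t j)) * marginLoss M a b ρ (1 / 2) (drawMean u t) y +
          M * ∑ t : Fin n → Fin T, (∏ j, α (t j)) * bad t := by
        rw [Finset.mul_sum, ← Finset.sum_add_distrib]
        exact Finset.sum_congr rfl fun t _ => by ring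
    _ ≤ _ := by
        gcongr
        exact sum_prod_mul_indicator_drawMean_le hα hn hρ hu y y'

/-- Raising the margin term from 1/2 to 1 absorbs a deviation of `ρ/2`, but now every competitor
must behave: the union bound runs over all outputs except `y`. -/
lemma sum_prod_mul_marginLoss_le (hα : α ∈ stdSimplex ℝ (Fin T)) {n : ℕ} (hn : 1 ≤ n)
    (hρ : 0 < ρ) {u : Fin T → Y → ℝ} (hu : ∀ s y, u s y ∈ Icc (0 : ℝ) 1)
    (hM : 0 ≤ M) (hb0 : ∀ y y', 0 ≤ b y y') (y : Y) :
    ∑ t : Fin n → Fin T, (∏ j, α (t j)) * marginLoss M a b ρ (1 / 2) (drawMean u t) y ≤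
      marginLoss M a b ρ 1 (fun y => ∑ s, α s * u s y) y +
        (Fintype.card Y - 1) * M * Real.exp (-(n * ρ ^ 2 / 8)) := by
  classical
  set f : Y → ℝ := fun y => ∑ s, α s * u s y with hf
  set bad : Y → (Fin n → Fin T) → ℝ := fun y' t =>
    if ρ / 2 < (drawMean u t y' - drawMean u t y) - (f y' - f y) then (1 : ℝ) else 0 with hbad
  have hbad0 : ∀ y' t, 0 ≤ bad y' t := fun y' t => by
    rw [hbad]; simp only; split_ifs <;> norm_num
  have hpt : ∀ t : Fin n → Fin T, marginLoss M a b ρ (1 / 2) (drawMean u t) y ≤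
      marginLoss M a b ρ 1 f y + M * ∑ y' ∈ Finset.univ.erase y, bad y' t := fun t => by
    have hm1 : 0 ≤ marginLoss M a b ρ 1 f y := (truncate_mem_Icc hM _).1
    have hm2 : marginLoss M a b ρ (1 / 2) (drawMean u t) y ≤ M := (truncate_mem_Icc hM _).2
    by_cases h : ∃ y', y' ≠ y ∧ ρ / 2 < (drawMean u t y' - drawMean u t y) - (f y' - f y)
    · obtain ⟨y', hne, hy'⟩ := h
      have h1 : 1 ≤ ∑ y' ∈ Finset.univ.erase y, bad y' t := by
        refine le_trans ?_ (Finset.single_le_sum (fun y' _ => hbad0 y' t)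
          (Finset.mem_erase.2 ⟨hne, Finset.mem_univ y'⟩))
        rw [hbad]; simp [hy']
      have := mul_le_mul_of_nonneg_left h1 hM
      linarith
    · push Not at h
      have h1 : marginLoss M a b ρ (1 / 2) (drawMean u t) y ≤ marginLoss M a b ρ 1 f y + 0 := by
        refine marginLoss_le_add le_rfl fun y' hne => ?_
        rw [add_zero]
        refine mul_le_mul_of_nonneg_left ?_ (hb0 _ _)
        have h2 : 1 / ρ * ((drawMean u t y' - drawMean u t y) - (f y' - f y)) ≤ 1 / ρ * (ρ / 2) :=
          mul_le_mul_of_nonneg_left (h y' hne) (by positivity)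
        have h3 : 1 / ρ * (ρ / 2) = 1 / 2 := by field_simp
        linarith
      have : 0 ≤ M * ∑ y' ∈ Finset.univ.erase y, bad y' t :=
        mul_nonneg hM (Finset.sum_nonneg fun y' _ => hbad0 y' t)
      linarith
  have hcard : ((Finset.univ.erase y).card : ℝ) = Fintype.card Y - 1 := by
    rw [Finset.card_erase_of_mem (Finset.mem_univ y), Finset.card_univ,
      Nat.cast_sub (Fintype.card_pos_iff.2 ⟨y⟩), Nat.cast_one]
  calc _ ≤ ∑ t : Fin n → Fin T, (∏ j, α (t j)) *
          (marginLoss M a b ρ 1 f y + M * ∑ y' ∈ Finset.univ.erase y, bad y' t) :=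
        Finset.sum_le_sum fun t _ =>
          mul_le_mul_of_nonneg_left (hpt t) (Finset.prod_nonneg fun j _ => hα.1 _)
    _ = marginLoss M a b ρ 1 f y + M * ∑ y' ∈ Finset.univ.erase y,
          ∑ t : Fin n → Fin T, (∏ j, α (t j)) * bad y' t := by
        simp_rw [mul_add]
        rw [Finset.sum_add_distrib, ← Finset.sum_mul, sum_prod_eq_one hα, one_mul, Finset.sum_comm,
          Finset.mul_sum]
        congr 1
        refine Finset.sum_congr rfl fun t _ => ?_
        rw [← Finset.mul_sum]
        ring
    _ ≤ marginLoss M a b ρ 1 f y + M * ∑ y' ∈ Finset.univ.erase y,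
          Real.exp (-(n * ρ ^ 2 / 8)) := by
        gcongr with y' _
        exact sum_prod_mul_indicator_drawMean_le hα hn hρ hu y' y
    _ = _ := by
        rw [Finset.sum_const, nsmul_eq_mul, hcard]
        ring

end Sampling

/-! ### From margin losses to the factor graph complexity. -/

section FactorGraphComplexity

open scoped BigOperators

variable {X : Type w} {Y : Type u} {G : X × Y → OutputGraph.{u, v} Y}

/-- The signed sum of the factor scores of `h` over the sample. -/
noncomputable def factorSum {m : ℕ} (S : Fin m → X × Y) (ε : SignIndex G S → ℤˣ)
    (h : FactoredScore G) : ℝ :=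
  ∑ i : Fin m, ∑ f : (G (S i)).Factor, ∑ y : (G (S i)).FactorLabel f,
    √((G (S i)).graph.numFactors : ℝ) * signVal (ε ⟨i, f, y⟩) * h.factor (S i) f y

-- Each sign vector may select its own member, so approximate maximizers can be used without asking
-- whether the supremum is finite or attained.
open Classical in
lemma expect_factorSum_le_empRademacher {m : ℕ} (S : Fin m → X × Y) {H : Set (FactoredScore G)}
    (sel : (SignIndex G S → ℤˣ) → FactoredScore G) (hsel : ∀ ε, sel ε ∈ H) :
    ((1 / (m : ℝ) * 𝔼 ε, factorSum S ε (sel ε) : ℝ) : EReal) ≤ empRademacher G S H := by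
  have h1 : 1 / (m : ℝ) * 𝔼 ε, factorSum S ε (sel ε) =
      (1 / (m : ℝ) * (1 / (2 : ℝ) ^ Fintype.card (SignIndex G S))) *
        ∑ ε, factorSum S ε (sel ε) := by
    rw [Fintype.expect_eq_sum_div_card, Fintype.card_fun, Fintype.card_units_int]
    push_cast
    ring
  rw [h1, EReal.coe_mul]
  unfold empRademacher
  refine mul_le_mul_of_nonneg_left ?_ (EReal.coe_nonneg.2 (by positivity))
  have h2 : ((∑ ε, factorSum S ε (sel ε) : ℝ) : EReal) =
      ∑ ε, ((factorSum S ε (sel ε) : ℝ) : EReal) := by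
    induction (Finset.univ : Finset (SignIndex G S → ℤˣ)) using Finset.induction_on with
    | empty => simp
    | insert a s ha ih => rw [Finset.sum_insert ha, Finset.sum_insert ha, EReal.coe_add, ih]
  rw [h2]
  exact Finset.sum_le_sum fun ε _ => le_iSup₂_of_le (sel ε) (hsel ε) le_rfl

/-- A single member already has mean zero under `ε ↦ -ε`. In particular the value `-∞` never occurs
in later sums. -/
lemma empRademacher_nonneg {m : ℕ} (S : Fin m → X × Y) {H : Set (FactoredScore G)}
    (hH : H.Nonempty) : 0 ≤ empRademacher G S H := by
  classical
  obtain ⟨h, hh⟩ := hH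
  have h1 := expect_factorSum_le_empRademacher S (fun _ => h) fun _ => hh
  have h2 : 𝔼 ε, factorSum S ε h = 𝔼 ε, -factorSum S ε h := by
    refine Fintype.expect_equiv (Equiv.neg _) _ _ fun ε => ?_
    simp [factorSum, signVal]
  rw [Finset.expect_neg_distrib] at h2
  rw [show 𝔼 ε, factorSum S ε h = 0 by linarith] at h1
  simpa using h1

lemma sub_sq_le_two_mul_sum_sq {J : Type*} [Fintype J] (d : J → ℝ) (j j' : J) :
    (d j - d j') ^ 2 ≤ 2 * ∑ j, d j ^ 2 := by
  classical
  have hnn : 0 ≤ ∑ j, d j ^ 2 := Finset.sum_nonneg fun j _ => sq_nonneg _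
  by_cases h : j = j'
  · subst h; simpa using hnn
  · have h1 : ∑ i ∈ {j, j'}, d i ^ 2 ≤ ∑ i, d i ^ 2 :=
      Finset.sum_le_sum_of_subset_of_nonneg (Finset.subset_univ _) fun i _ _ => sq_nonneg _
    rw [Finset.sum_pair h] at h1
    nlinarith [sq_nonneg (d j + d j')]

/-- The pointwise mean of the scores of a tuple of scoring functions. -/
noncomputable def scoreMean {n : ℕ} (θ : Fin n → FactoredScore G) (x : X) (y : Y) : ℝ :=
  1 / (n : ℝ) * ∑ l, (θ l).score x y

/-- The mean of the factor scores of a tuple of scoring functions. -/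
noncomputable def factorMean {n : ℕ} (θ : Fin n → FactoredScore G) (z : X × Y)
    (j : Σ f : (G z).Factor, (G z).FactorLabel f) : ℝ :=
  1 / (n : ℝ) * ∑ l, (θ l).factor z j.1 j.2

lemma scoreMean_eq_sum {n : ℕ} (θ : Fin n → FactoredScore G) (z : X × Y) (y' : Y) :
    scoreMean θ z.1 y' =
      ∑ f : (G z).Factor, factorMean θ z ⟨f, (G z).restrict f y'⟩ := by
  unfold scoreMean factorMean
  rw [← Finset.mul_sum, Finset.sum_comm]
  congr 1
  exact Finset.sum_congr rfl fun l _ => (θ l).score_eq z.1 z.2 y'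

/-- Cauchy–Schwarz over the factors gives `|F|`; within one factor the two outputs read at most two
labels, which gives the 2. -/
lemma abs_scoreMean_sub_le {n : ℕ} (θ θ' : Fin n → FactoredScore G) (z : X × Y) (y y' : Y) :
    |(scoreMean θ z.1 y - scoreMean θ' z.1 y) - (scoreMean θ z.1 y' - scoreMean θ' z.1 y')| ≤
      √(2 * (G z).graph.numFactors * ∑ j, (factorMean θ z j - factorMean θ' z j) ^ 2) := by
  refine Real.abs_le_sqrt ?_
  simp_rw [scoreMean_eq_sum, ← Finset.sum_sub_distrib]
  refine (sq_sum_le_card_mul_sum_sq).trans ?_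
  rw [Finset.card_univ, Fintype.card_fin, mul_comm (2 : ℝ), mul_assoc]
  refine mul_le_mul_of_nonneg_left ?_ (Nat.cast_nonneg _)
  rw [Fintype.sum_sigma, Finset.mul_sum]
  refine Finset.sum_le_sum fun f _ => ?_
  exact sub_sq_le_two_mul_sum_sq
    (fun y => factorMean θ z ⟨f, y⟩ - factorMean θ' z ⟨f, y⟩) _ _

variable [Finite Y] {M ρ τ B : ℝ} {a b : Y → Y → ℝ}

-- Vector contraction with the factor scores scaled by `√2 B/ρ · √|F_i|`, which is where the weight
-- `√|F_i|` in the complexity comes from.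
open Classical in
lemma expect_ciSup_marginLoss_le {m n : ℕ} (S : Fin m → X × Y) (hρ : 0 < ρ)
    (hb0 : ∀ y y', 0 ≤ b y y') (hbB : ∀ y y', b y y' ≤ B) {Θ : Type*} [Finite Θ] [Nonempty Θ]
    (θ : Θ → Fin n → FactoredScore G) :
    𝔼 ε : Fin m → ℤˣ, ⨆ k, ∑ i, signVal (ε i) *
        marginLoss M a b ρ τ (scoreMean (θ k) (S i).1) (S i).2 ≤
      𝔼 ε : SignIndex G S → ℤˣ, ⨆ k, 2 * √2 * B / ρ * (1 / (n : ℝ) *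
        ∑ l, factorSum S ε (θ k l)) := by
  have h := expect_ciSup_contraction
    (fun i => Σ f : (G (S i)).Factor, (G (S i)).FactorLabel f) (0 : Θ → ℝ)
    (fun i k => marginLoss M a b ρ τ (scoreMean (θ k) (S i).1) (S i).2)
    (fun i j k => √2 * B / ρ * √((G (S i)).graph.numFactors : ℝ) * factorMean (θ k) (S i) j)
    fun i k k' => by
      have hB : 0 ≤ B := (hb0 (S i).2 (S i).2).trans (hbB _ _)
      have h1 := marginLoss_le_add_of_forall_abs_le (M := M) (a := a) (τ := τ) hρ hb0 hbB
        (Real.sqrt_nonneg _) fun y' _ => abs_scoreMean_sub_le (θ k) (θ k') (S i) (S i).2 y'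
      refine (sub_le_iff_le_add'.2 h1).trans (le_of_eq ?_)
      simp_rw [← mul_sub, mul_pow]
      rw [← Finset.mul_sum, ← Real.sqrt_sq (show 0 ≤ B / ρ by positivity),
        ← Real.sqrt_mul (sq_nonneg _)]
      congr 1
      rw [Real.sq_sqrt (Nat.cast_nonneg _), div_pow (√2 * B), mul_pow, Real.sq_sqrt (by norm_num)]
      ring
  simp only [Pi.zero_apply, zero_add] at h
  refine h.trans (le_of_eq ?_)
  refine (Fintype.expect_equiv (Equiv.piCurry fun (i : Fin m)
    (_ : Σ f : (G (S i)).Factor, (G (S i)).FactorLabel f) => ℤˣ) _ _ fun ε => ?_).symm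
  congr 1
  ext k
  have h2 : 1 / (n : ℝ) * ∑ l, factorSum S ε (θ k l) =
      ∑ i, ∑ j, √((G (S i)).graph.numFactors : ℝ) * signVal (ε ⟨i, j⟩) *
        factorMean (θ k) (S i) j := by
    unfold factorSum factorMean
    simp_rw [Fintype.sum_sigma, Finset.mul_sum]
    rw [Finset.sum_comm]
    refine Finset.sum_congr rfl fun i _ => ?_
    rw [Finset.sum_comm]
    refine Finset.sum_congr rfl fun f _ => ?_
    rw [Finset.sum_comm]
    refine Finset.sum_congr rfl fun y _ => Finset.sum_congr rfl fun l _ => ?_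
    ring
  rw [h2, Finset.mul_sum, Finset.mul_sum]
  refine Finset.sum_congr rfl fun i _ => ?_
  rw [Finset.mul_sum, Finset.mul_sum]
  refine Finset.sum_congr rfl fun j _ => ?_
  simp only [Equiv.piCurry_apply, Sigma.curry]
  ring

/-- The Rademacher complexity of the margin losses of means of tuples is controlled by the factor
graph complexities of the families of the components. -/
theorem rademacherAvg_marginLoss_le {m n : ℕ} (S : Fin m → X × Y) (hρ : 0 < ρ) (hB : 0 ≤ B)
    (hb0 : ∀ y y', 0 ≤ b y y') (hbB : ∀ y y', b y y' ≤ B) {ι : Type*} [Nonempty ι]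
    (θ : ι → Fin n → FactoredScore G) (H : Fin n → Set (FactoredScore G))
    (hθ : ∀ i l, θ i l ∈ H l) (r : Fin n → ℝ) (hr : ∀ l, empRademacher G S (H l) ≤ r l) :
    rademacherAvg (fun i (z : X × Y) => marginLoss M a b ρ τ (scoreMean (θ i) z.1) z.2) S ≤
      2 * √2 * B / ρ * (1 / (n : ℝ) * ∑ l, r l) := by
  classical
  refine le_of_forall_pos_le_add fun η hη => ?_
  set V : (Fin m → ℤˣ) → ι → ℝ := fun ε i => 1 / (m : ℝ) * ∑ j, signVal (ε j) *
    marginLoss M a b ρ τ (scoreMean (θ i) (S j).1) (S j).2 with hV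
  -- One near-maximizer per sign vector reduces an arbitrary index set to a finite one, as the
  -- contraction requires.
  have hex : ∀ ε, ∃ i, (⨆ i, V ε i) < V ε i + η := fun ε => by
    obtain ⟨i, hi⟩ := exists_lt_of_lt_ciSup (sub_lt_self (⨆ i, V ε i) hη)
    exact ⟨i, by linarith⟩
  choose sel hsel using hex
  have hfin := expect_ciSup_marginLoss_le (M := M) (a := a) (τ := τ) S hρ hb0 hbB
    fun k : Fin m → ℤˣ => θ (sel k)
  have hatt : ∀ ε : SignIndex G S → ℤˣ, ∃ k : Fin m → ℤˣ,
      2 * √2 * B / ρ * (1 / (n : ℝ) * ∑ l, factorSum S ε (θ (sel k) l)) =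
      ⨆ k : Fin m → ℤˣ, 2 * √2 * B / ρ * (1 / (n : ℝ) * ∑ l, factorSum S ε (θ (sel k) l)) :=
    fun ε => exists_eq_ciSup_of_finite
  choose κ hκ using hatt
  simp_rw [← hκ] at hfin
  have hl : ∀ l, 1 / (m : ℝ) * 𝔼 ε, factorSum S ε (θ (sel (κ ε)) l) ≤ r l := fun l =>
    EReal.coe_le_coe_iff.1 ((expect_factorSum_le_empRademacher S
      (fun ε => θ (sel (κ ε)) l) fun ε => hθ _ _).trans (hr l))
  calc rademacherAvg _ S = 𝔼 ε, ⨆ i, V ε i := by rw [rademacherAvg]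
    _ ≤ 𝔼 ε : Fin m → ℤˣ, (1 / (m : ℝ) * (⨆ k : Fin m → ℤˣ, ∑ j, signVal (ε j) *
          marginLoss M a b ρ τ (scoreMean (θ (sel k)) (S j).1) (S j).2) + η) := by
        refine Finset.expect_le_expect fun ε _ => (hsel ε).le.trans ?_
        refine add_le_add_left (mul_le_mul_of_nonneg_left ?_ (by positivity)) η
        exact le_ciSup (f := fun k : Fin m → ℤˣ => ∑ j, signVal (ε j) *
          marginLoss M a b ρ τ (scoreMean (θ (sel k)) (S j).1) (S j).2)
          (finite_range _).bddAbove ε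
    _ = 1 / (m : ℝ) * (𝔼 ε : Fin m → ℤˣ, ⨆ k : Fin m → ℤˣ, ∑ j, signVal (ε j) *
          marginLoss M a b ρ τ (scoreMean (θ (sel k)) (S j).1) (S j).2) + η := by
        rw [Finset.expect_add_distrib, Fintype.expect_const, Finset.mul_expect]
    _ ≤ 1 / (m : ℝ) * (𝔼 ε, 2 * √2 * B / ρ * (1 / (n : ℝ) *
          ∑ l, factorSum S ε (θ (sel (κ ε)) l))) + η := by
        exact add_le_add_left (mul_le_mul_of_nonneg_left hfin (by positivity)) η
    _ = 2 * √2 * B / ρ * (1 / (n : ℝ) *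
          ∑ l, (1 / (m : ℝ) * 𝔼 ε, factorSum S ε (θ (sel (κ ε)) l))) + η := by
        rw [← Finset.mul_expect, ← Finset.mul_expect, Finset.expect_sum_comm, ← Finset.mul_sum]
        ring
    _ ≤ _ := by
        exact add_le_add_left (mul_le_mul_of_nonneg_left (mul_le_mul_of_nonneg_left
          (Finset.sum_le_sum fun l _ => hl l) (by positivity)) (by positivity)) η

end FactorGraphComplexity

/-! ### Uniform deviation for one class of averages. -/

section UniformBound

variable {X : Type w} {Y : Type u} {G : X × Y → OutputGraph.{u, v} Y}

/-- Separability concerns scores only; a decomposition is chosen for each score of the countable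
subfamily. The factors themselves need not converge. -/
lemma PointwiseSeparable.exists_countable_subset {H : Set (FactoredScore G)}
    (hH : PointwiseSeparable (FactoredScore.score '' H)) :
    ∃ C ⊆ H, C.Countable ∧ ∀ h ∈ H, ∃ b : ℕ → FactoredScore G, (∀ n, b n ∈ C) ∧
      ∀ x y, Tendsto (fun n => (b n).score x y) atTop (𝓝 (h.score x y)) := by
  obtain ⟨B, hBH, hBc, hB⟩ := hH
  choose f hfH hf using hBH
  have := hBc.to_subtype
  refine ⟨range fun b : B => f b.2, ?_, countable_range _, fun h hh => ?_⟩
  · rintro _ ⟨b, rfl⟩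
    exact hfH b.2
  · obtain ⟨b, hbB, hb⟩ := hB _ (mem_image_of_mem _ hh)
    refine ⟨fun n => f (hbB n), fun n => ⟨⟨b n, hbB n⟩, rfl⟩, fun x y => ?_⟩
    simp_rw [hf]
    exact hb x y

variable [MeasurableSpace X]

lemma measurable_scoreMean {n : ℕ} {θ : Fin n → FactoredScore G}
    (hθ : ∀ l y, Measurable fun x => (θ l).score x y) (y : Y) :
    Measurable fun x => scoreMean θ x y :=
  (Finset.measurable_sum _ fun l _ => hθ l y).const_mul _

variable [Finite Y] [MeasurableSpace Y] [MeasurableSingletonClass Y]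
  {M ρ τ B : ℝ} {a b : Y → Y → ℝ}

lemma measurable_marginLoss_comp (hρ : 0 < ρ) (hb0 : ∀ y y', 0 ≤ b y y')
    (hbB : ∀ y y', b y y' ≤ B) {h : X → Y → ℝ} (hh : ∀ y, Measurable fun x => h x y) :
    Measurable fun z : X × Y => marginLoss M a b ρ τ (h z.1) z.2 :=
  measurable_from_prod_countable_left fun y =>
    (continuous_marginLoss hρ hb0 hbB y).measurable.comp (measurable_pi_iff.2 hh)

/-- Uniform deviation of the margin losses over the means of tuples with components in separable
families. -/
theorem exists_tuple_deviation_event (D : Measure (X × Y)) [IsProbabilityMeasure D] {m n : ℕ}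
    (hm : 1 ≤ m) (hρ : 0 < ρ) (hM : 0 < M) (hB : 0 ≤ B) (hb0 : ∀ y y', 0 ≤ b y y')
    (hbB : ∀ y y', b y y' ≤ B) (H : Fin n → Set (FactoredScore G))
    (hH_meas : ∀ l, ∀ h ∈ H l, ∀ y, Measurable fun x => h.score x y)
    (hH_sep : ∀ l, PointwiseSeparable (FactoredScore.score '' H l)) {s : ℝ} (hs : 0 ≤ s) :
    ∃ A : Set (Fin m → X × Y), MeasurableSet A ∧
      (Measure.pi fun _ : Fin m => D).real Aᶜ ≤ Real.exp (-s) ∧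
      ∀ S ∈ A, ∀ θ : Fin n → FactoredScore G, (∀ l, θ l ∈ H l) → ∀ r : Fin n → ℝ,
        (∀ l, empRademacher G S (H l) ≤ r l) →
        ∫ z, marginLoss M a b ρ τ (scoreMean θ z.1) z.2 ∂D ≤
          1 / (m : ℝ) * ∑ j, marginLoss M a b ρ τ (scoreMean θ (S j).1) (S j).2 +
            4 * √2 * B / ρ * (1 / (n : ℝ) * ∑ l, r l) + 3 * M * √(s / (2 * m)) := by
  by_cases hne : ∀ l, (H l).Nonempty
  swap
  · push Not at hne
    obtain ⟨l, hl⟩ := hne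
    refine ⟨univ, MeasurableSet.univ, by simpa using (Real.exp_pos _).le, fun S _ θ hθ => ?_⟩
    exact absurd (hθ l) (by simp [hl])
  choose C hCH hCc hC using fun l => (hH_sep l).exists_countable_subset
  have hCne : ∀ l, Nonempty (C l) := fun l => by
    obtain ⟨h, hh⟩ := hne l
    obtain ⟨b, hb, _⟩ := hC l h hh
    exact ⟨⟨b 0, hb 0⟩⟩
  have hCct : ∀ l, Countable (C l) := fun l => (hCc l).to_subtype
  set θ₀ : (∀ l, C l) → Fin n → FactoredScore G := fun i l => (i l : FactoredScore G) with hθ₀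
  set φ : (Fin n → FactoredScore G) → X × Y → ℝ := fun θ z =>
    marginLoss M a b ρ τ (scoreMean θ z.1) z.2 with hφ
  have hφm : ∀ θ : Fin n → FactoredScore G, (∀ l, θ l ∈ H l) → Measurable (φ θ) := fun θ hθ =>
    measurable_marginLoss_comp hρ hb0 hbB
      (measurable_scoreMean fun l y => hH_meas l _ (hθ l) y)
  have hφM : ∀ θ z, φ θ z ∈ Icc 0 M := fun θ z => truncate_mem_Icc hM.le _
  obtain ⟨A, hA, hAm, hAS⟩ := exists_uniform_deviation_event D (φ := fun i => φ (θ₀ i))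
    (fun i => hφm _ fun l => hCH l (i l).2) (fun i => hφM _) hm hM hs
  refine ⟨A, hA, hAm, fun S hS θ hθ r hr => ?_⟩
  choose β hβC hβ using fun l => hC l (θ l) (hθ l)
  set θs : ℕ → Fin n → FactoredScore G := fun N l => β l N with hθs
  -- The event was built from the bounded losses of a countable class. The factor graph complexity
  -- enters only here, for a fixed sample, so it need be neither measurable nor bounded in `S`.
  have hrad := rademacherAvg_marginLoss_le (M := M) (a := a) (τ := τ) S hρ hB hb0 hbB θ₀ H
    (fun i l => hCH l (i l).2) r hr
  have hN : ∀ N, ∫ z, φ (θs N) z ∂D ≤ 1 / (m : ℝ) * ∑ j, φ (θs N) (S j) +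
      (4 * √2 * B / ρ * (1 / (n : ℝ) * ∑ l, r l) + 3 * M * √(s / (2 * m))) := fun N => by
    have h1 := hAS S hS fun l => ⟨β l N, hβC l N⟩
    have h2 : 4 * √2 * B / ρ * (1 / (n : ℝ) * ∑ l, r l) =
        2 * (2 * √2 * B / ρ * (1 / (n : ℝ) * ∑ l, r l)) := by ring
    rw [h2]
    refine h1.trans ?_
    rw [add_assoc]
    gcongr
  have hlim : ∀ z, Tendsto (fun N => φ (θs N) z) atTop (𝓝 (φ θ z)) := fun z => by
    refine ((continuous_marginLoss hρ hb0 hbB z.2).tendsto _).comp (tendsto_pi_nhds.2 fun y => ?_)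
    exact (tendsto_finsetSum _ fun l _ => hβ l z.1 y).const_mul _
  have hlimI : Tendsto (fun N => ∫ z, φ (θs N) z ∂D) atTop (𝓝 (∫ z, φ θ z ∂D)) := by
    refine tendsto_integral_of_dominated_convergence (fun _ => M)
      (fun N => (hφm _ fun l => hCH l (hβC l N)).aestronglyMeasurable) (integrable_const M)
      (fun N => ae_of_all _ fun z => ?_) (ae_of_all _ hlim)
    rw [Real.norm_of_nonneg (hφM _ _).1]
    exact (hφM _ _).2
  have hlimS : Tendsto (fun N => 1 / (m : ℝ) * ∑ j, φ (θs N) (S j) +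
      (4 * √2 * B / ρ * (1 / (n : ℝ) * ∑ l, r l) + 3 * M * √(s / (2 * m)))) atTop
      (𝓝 (1 / (m : ℝ) * ∑ j, φ θ (S j) +
      (4 * √2 * B / ρ * (1 / (n : ℝ) * ∑ l, r l) + 3 * M * √(s / (2 * m))))) :=
    ((tendsto_finsetSum _ fun j _ => hlim (S j)).const_mul _).add_const _
  rw [add_assoc]
  exact le_of_tendsto_of_tendsto' hlimI hlimS hN

end UniformBound

/-! ### From random averages back to the ensemble. -/

section EnsembleBound

variable {X : Type w} {Y : Type u} {G : X × Y → OutputGraph.{u, v} Y} [MeasurableSpace X]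
  [Fintype Y] [MeasurableSpace Y] [MeasurableSingletonClass Y]

/-- Averaging the bounds for the means of tuples gives the bound for the ensemble. -/
lemma risk_le_of_tuple_bounds (D : Measure (X × Y)) [IsProbabilityMeasure D] {L : Y → Y → ℝ}
    (hL_nonneg : ∀ y y', 0 ≤ L y y') (hL_zero : ∀ y, L y y = 0) {ρ B : ℝ} (hρ : 0 < ρ)
    {b : Y → Y → ℝ} (hb0 : ∀ y y', 0 ≤ b y y') (hbB : ∀ y y', b y y' ≤ B) {m n T : ℕ}
    (hm : 1 ≤ m) (hn : 1 ≤ n) (S : Fin m → X × Y) {α : Fin T → ℝ} (hα : α ∈ stdSimplex ℝ (Fin T))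
    (h : Fin T → FactoredScore G) (h_range : ∀ t x y, (h t).score x y ∈ Icc (0 : ℝ) 1)
    (h_meas : ∀ t y, Measurable fun x => (h t).score x y) (r : Fin T → ℝ) {K ξ : ℝ}
    (hbound : ∀ t : Fin n → Fin T, (∀ j, α (t j) ≠ 0) →
      ∫ z, marginLoss (lossMax L) L b ρ (1 / 2) (scoreMean (fun j => h (t j)) z.1) z.2 ∂D ≤
        1 / (m : ℝ) * ∑ i, marginLoss (lossMax L) L b ρ (1 / 2)
          (scoreMean (fun j => h (t j)) (S i).1) (S i).2 +
        K * (1 / (n : ℝ) * ∑ j, r (t j)) + ξ)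
    {g : X → Y} (hgm : Measurable g) (hg : IsPredictor (ensemble α h) g) :
    risk D L g ≤ sampleMean S (fun x => marginLoss (lossMax L) L b ρ 1 (ensemble α h x)) +
      K * ∑ t, α t * r t + Fintype.card Y * lossMax L * Real.exp (-(n * ρ ^ 2 / 8)) + ξ := by
  have hn' : (n : ℝ) ≠ 0 := by positivity
  have hm' : (m : ℝ) ≠ 0 := by positivity
  obtain ⟨y₀⟩ : Nonempty Y := (nonempty_of_isProbabilityMeasure D).map Prod.snd
  set M := lossMax L with hMdef
  have hM : 0 ≤ M := (hL_nonneg y₀ y₀).trans (le_lossMax L _ _)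
  set e := Real.exp (-(n * ρ ^ 2 / 8)) with he
  set φ : (Fin n → Fin T) → X × Y → ℝ := fun t z =>
    marginLoss M L b ρ (1 / 2) (scoreMean (fun j => h (t j)) z.1) z.2 with hφ
  have hφM : ∀ t z, φ t z ∈ Icc 0 M := fun t z => truncate_mem_Icc hM _
  have hφm : ∀ t, Measurable (φ t) := fun t =>
    measurable_marginLoss_comp hρ hb0 hbB (measurable_scoreMean fun j y => h_meas (t j) y)
  have hφi : ∀ t, Integrable (φ t) D := fun t =>
    Integrable.of_mem_Icc 0 M (hφm t).aemeasurable (ae_of_all _ (hφM t))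
  have hw0 : ∀ t : Fin n → Fin T, 0 ≤ ∏ j, α (t j) := fun t => Finset.prod_nonneg fun j _ => hα.1 _
  have hlow : ∀ z : X × Y, L (g z.1) z.2 ≤ ∑ t, (∏ j, α (t j)) * φ t z + M * e := fun z =>
    le_sum_prod_mul_marginLoss (u := fun s => (h s).score z.1) hα hn hρ
      (fun s y => h_range s z.1 y) hM (le_lossMax L) hL_zero hb0 (hg z.1 z.2)
  have hup : ∀ z : X × Y, ∑ t, (∏ j, α (t j)) * φ t z ≤
      marginLoss M L b ρ 1 (ensemble α h z.1) z.2 + (Fintype.card Y - 1) * M * e := fun z =>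
    sum_prod_mul_marginLoss_le (u := fun s => (h s).score z.1) hα hn hρ
      (fun s y => h_range s z.1 y) hM hb0 z.2
  have hLm : Measurable fun z : X × Y => L (g z.1) z.2 :=
    (measurable_of_countable fun q : Y × Y => L q.1 q.2).comp
      ((hgm.comp measurable_fst).prodMk measurable_snd)
  have hLi : Integrable (fun z : X × Y => L (g z.1) z.2) D :=
    Integrable.of_mem_Icc 0 M hLm.aemeasurable
      (ae_of_all _ fun z => ⟨hL_nonneg _ _, le_lossMax L _ _⟩)
  have hsumi : Integrable (fun z => ∑ t, (∏ j, α (t j)) * φ t z) D :=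
    integrable_finsetSum _ fun t _ => (hφi t).const_mul _
  calc risk D L g ≤ ∫ z, (∑ t, (∏ j, α (t j)) * φ t z + M * e) ∂D :=
        integral_mono hLi (hsumi.add (integrable_const _)) hlow
    _ = ∑ t : Fin n → Fin T, (∏ j, α (t j)) * ∫ z, φ t z ∂D + M * e := by
        rw [integral_add hsumi (integrable_const _),
          integral_finsetSum _ fun t _ => (hφi t).const_mul _]
        simp [integral_const_mul]
    _ ≤ ∑ t : Fin n → Fin T, (∏ j, α (t j)) * (1 / (m : ℝ) * ∑ i, φ t (S i) +
          K * (1 / (n : ℝ) * ∑ j, r (t j)) + ξ) + M * e := by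
        gcongr ?_ + _
        refine Finset.sum_le_sum fun t _ => ?_
        -- Draws that use a zero weight have probability zero, so no bound is needed for families
        -- met only there, whose complexity may be infinite.
        by_cases ht : ∀ j, α (t j) ≠ 0
        · exact mul_le_mul_of_nonneg_left (hbound t ht) (hw0 t)
        · push Not at ht
          obtain ⟨j, hj⟩ := ht
          rw [Finset.prod_eq_zero (Finset.mem_univ j) hj, zero_mul, zero_mul]
    _ = 1 / (m : ℝ) * ∑ i, ∑ t : Fin n → Fin T, (∏ j, α (t j)) * φ t (S i) +
          K * (1 / (n : ℝ) * ∑ t : Fin n → Fin T, (∏ j, α (t j)) * ∑ j, r (t j)) +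
          ξ * (∑ t : Fin n → Fin T, ∏ j, α (t j)) + M * e := by
        congr 1
        have h1 : ∑ i, ∑ t : Fin n → Fin T, (∏ j, α (t j)) * φ t (S i) =
            ∑ t : Fin n → Fin T, (∏ j, α (t j)) * ∑ i, φ t (S i) := by
          rw [Finset.sum_comm]
          simp_rw [Finset.mul_sum]
        rw [h1, ← mul_assoc K, Finset.mul_sum, Finset.mul_sum, Finset.mul_sum,
          ← Finset.sum_add_distrib, ← Finset.sum_add_distrib]
        exact Finset.sum_congr rfl fun t _ => by ring
    _ ≤ 1 / (m : ℝ) * ∑ i, (marginLoss M L b ρ 1 (ensemble α h (S i).1) (S i).2 +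
          (Fintype.card Y - 1) * M * e) + K * ∑ t, α t * r t + ξ + M * e := by
        rw [sum_prod_mul_sum hα, sum_prod_eq_one hα, mul_one, ← mul_assoc (1 / (n : ℝ)),
          one_div_mul_cancel hn', one_mul]
        gcongr with i _
        exact hup (S i)
    _ = _ := by
        rw [Finset.sum_add_distrib, mul_add]
        simp only [Finset.sum_const, Finset.card_univ, Fintype.card_fin, nsmul_eq_mul, sampleMean]
        rw [← mul_assoc (1 / (m : ℝ)) (m : ℝ), one_div_mul_cancel hm', one_mul]
        ring

end EnsembleBound

/-! ### The constant and the number of draws. -/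

section Constants

lemma vrmConst_nonneg {ρ M : ℝ} (hρ : 0 < ρ) (hM : 0 ≤ M) (c m p : ℕ) (δ : ℝ) :
    0 ≤ vrmConst ρ M c m p δ := by
  unfold vrmConst
  positivity

/-- If the argument of the logarithm were at most 1, then `ρ/2 ≤ √(log p / m)` and the first term of
the constant alone would reach `M`. -/
lemma one_lt_of_vrmConst_lt {ρ M δ : ℝ} {c m p : ℕ} (hρ : 0 < ρ) (hM : 0 ≤ M) (hc : 1 ≤ c)
    (hm : 1 ≤ m) (hp : 2 ≤ p) (h : vrmConst ρ M c m p δ < M) :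
    1 < (c : ℝ) ^ 2 * ρ ^ 2 * m / (4 * Real.log p) := by
  have hlog : 0 < Real.log p := Real.log_pos (by exact_mod_cast hp)
  have hm' : (0 : ℝ) < m := by exact_mod_cast hm
  have hc' : (1 : ℝ) ≤ c := by exact_mod_cast hc
  by_contra! hq
  rw [div_le_one (by positivity)] at hq
  have h1 : ρ / 2 ≤ √(Real.log p / m) := by
    refine Real.le_sqrt_of_sq_le ?_
    rw [le_div_iff₀ hm']
    have : (1 : ℝ) ≤ (c : ℝ) ^ 2 := one_le_pow₀ hc'
    nlinarith [mul_le_mul_of_nonneg_right this (show 0 ≤ ρ ^ 2 * m by positivity)]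
  have h2 : M ≤ 2 * M / ρ * √(Real.log p / m) := by
    calc M = 2 * M / ρ * (ρ / 2) := by field_simp
      _ ≤ _ := by gcongr
  have h3 : 2 * M / ρ * √(Real.log p / m) ≤ vrmConst ρ M c m p δ :=
    le_add_of_nonneg_right (by positivity)
  linarith

/-- With `q` the argument of the logarithm, the choice of `n` gives `e² ≤ 1/q`, and `c²/q` is
exactly the square of `(2/ρ)√(log p / m)`. The second term has room to spare: 3 against 9, and `log
p / (2m)` against `log p / m`. -/
lemma card_mul_exp_add_le_vrmConst {ρ M δ : ℝ} {c m p n : ℕ} (hρ : 0 < ρ) (hM : 0 ≤ M)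
    (hm : 1 ≤ m) (hp : 2 ≤ p) (hδ : 0 < δ) (hδ1 : δ < 1)
    (hq : 1 < (c : ℝ) ^ 2 * ρ ^ 2 * m / (4 * Real.log p))
    (hn : (n : ℤ) = ⌈4 / ρ ^ 2 * Real.log ((c : ℝ) ^ 2 * ρ ^ 2 * m / (4 * Real.log p))⌉) :
    c * M * Real.exp (-(n * ρ ^ 2 / 8)) +
      3 * M * √((n * Real.log p + Real.log (2 / δ)) / (2 * m)) ≤ vrmConst ρ M c m p δ := by
  have hlog : 0 < Real.log p := Real.log_pos (by exact_mod_cast hp)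
  have hlogδ : 0 < Real.log (2 / δ) := Real.log_pos (by rw [lt_div_iff₀ hδ]; linarith)
  have hm' : (0 : ℝ) < m := by exact_mod_cast hm
  set q := (c : ℝ) ^ 2 * ρ ^ 2 * m / (4 * Real.log p) with hqdef
  have hq0 : 0 < q := by linarith
  have hnR : (⌈4 / ρ ^ 2 * Real.log q⌉ : ℝ) = n := by rw [← hn]; simp
  have hnge : 4 / ρ ^ 2 * Real.log q ≤ n := hnR ▸ Int.le_ceil _
  have hexp : c * Real.exp (-(n * ρ ^ 2 / 8)) ≤ 2 / ρ * √(Real.log p / m) := by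
    refine (pow_le_pow_iff_left₀ (by positivity) (by positivity) two_ne_zero).1 ?_
    have h1 : Real.exp (-(n * ρ ^ 2 / 8)) ^ 2 ≤ q⁻¹ := by
      rw [← Real.exp_nat_mul, ← Real.exp_log hq0, ← Real.exp_neg]
      refine Real.exp_le_exp.2 ?_
      have h2 : 4 / ρ ^ 2 * Real.log q * (ρ ^ 2 / 4) ≤ n * (ρ ^ 2 / 4) :=
        mul_le_mul_of_nonneg_right hnge (by positivity)
      have h3 : 4 / ρ ^ 2 * Real.log q * (ρ ^ 2 / 4) = Real.log q := by field_simp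
      push_cast
      linarith
    rw [mul_pow, mul_pow, Real.sq_sqrt (by positivity)]
    have hc0 : (c : ℝ) ≠ 0 := by
      rintro hc
      rw [hqdef, hc] at hq
      norm_num at hq
    calc (c : ℝ) ^ 2 * Real.exp (-(n * ρ ^ 2 / 8)) ^ 2 ≤ (c : ℝ) ^ 2 * q⁻¹ := by gcongr
      _ = _ := by rw [hqdef]; field_simp; norm_num
  have hsqrt : √((n * Real.log p + Real.log (2 / δ)) / (2 * m)) ≤
      √(n * (Real.log p / m) + Real.log (2 / δ) / (2 * m)) := by
    refine Real.sqrt_le_sqrt ?_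
    rw [add_div]
    gcongr
    rw [mul_div_assoc]
    gcongr
    linarith
  unfold vrmConst
  rw [← hqdef, hnR]
  refine add_le_add ?_ ?_
  · calc c * M * Real.exp (-(n * ρ ^ 2 / 8)) = M * (c * Real.exp (-(n * ρ ^ 2 / 8))) := by ring
      _ ≤ M * (2 / ρ * √(Real.log p / m)) := by gcongr
      _ = _ := by ring
  · refine mul_le_mul (by linarith) hsqrt (Real.sqrt_nonneg _) (by positivity)

end Constants

/-! ### Extended real bookkeeping and the main theorem. -/

section Main

variable {X : Type w} {Y : Type u} {G : X × Y → OutputGraph.{u, v} Y}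

lemma sum_coe_mul_nonneg {T : ℕ} {α : Fin T → ℝ} (hα : ∀ t, 0 ≤ α t) {R : Fin T → EReal}
    (hR : ∀ t, 0 ≤ R t) : 0 ≤ ∑ t, (α t : EReal) * R t :=
  Finset.sum_nonneg fun t _ => mul_nonneg (EReal.coe_nonneg.2 (hα t)) (hR t)

/-- A real bound that holds whenever the complexities with nonzero weight are finite extends to the
extended reals. -/
lemma coe_le_coe_mul_sum_add {T : ℕ} {α : Fin T → ℝ} (hα : ∀ t, 0 ≤ α t) {R : Fin T → EReal}
    (hR : ∀ t, 0 ≤ R t) {a K C : ℝ} (hK : 0 < K)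
    (h : (∀ t, α t ≠ 0 → R t ≤ ((R t).toReal : EReal)) →
      a ≤ K * ∑ t, α t * (R t).toReal + C) :
    (a : EReal) ≤ (K : EReal) * ∑ t, (α t : EReal) * R t + (C : EReal) := by
  by_cases hfin : ∀ t, α t ≠ 0 → R t ≠ ⊤
  · have hterm : ∀ t, (α t : EReal) * R t = ((α t * (R t).toReal : ℝ) : EReal) := fun t => by
      by_cases ht : α t = 0
      · simp [ht]
      · rw [EReal.coe_mul, EReal.coe_toReal (hfin t ht)
          (ne_of_gt (lt_of_lt_of_le EReal.bot_lt_zero (hR t)))]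
    have hsum : ∑ t, (α t : EReal) * R t = ((∑ t, α t * (R t).toReal : ℝ) : EReal) := by
      simp_rw [hterm]
      exact (map_sum (⟨⟨Real.toEReal, rfl⟩, EReal.coe_add⟩ : ℝ →+ EReal) _ _).symm
    rw [hsum, ← EReal.coe_mul, ← EReal.coe_add, EReal.coe_le_coe_iff]
    exact h fun t ht => EReal.le_coe_toReal (hfin t ht)
  · push Not at hfin
    obtain ⟨t, ht, htop⟩ := hfin
    have hsum : ∑ t, (α t : EReal) * R t = ⊤ := by
      rw [← Finset.add_sum_erase _ _ (Finset.mem_univ t), htop,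
        EReal.coe_mul_top_of_pos (lt_of_le_of_ne (hα t) (Ne.symm ht))]
      refine EReal.top_add_of_ne_bot (ne_of_gt (lt_of_lt_of_le EReal.bot_lt_zero ?_))
      exact Finset.sum_nonneg fun t _ => mul_nonneg (EReal.coe_nonneg.2 (hα t)) (hR t)
    rw [hsum, EReal.coe_mul_top_of_pos hK, EReal.top_add_coe]
    exact le_top

lemma risk_le_lossMax [MeasurableSpace X] [Finite Y] [MeasurableSpace Y] (D : Measure (X × Y))
    [IsProbabilityMeasure D] {L : Y → Y → ℝ} (hL : ∀ y y', 0 ≤ L y y') (g : X → Y) :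
    risk D L g ≤ lossMax L := by
  have := integral_mono_of_nonneg (μ := D) (ae_of_all _ fun z => hL (g z.1) z.2)
    (integrable_const (lossMax L)) (ae_of_all _ fun z => le_lossMax L (g z.1) z.2)
  simpa [risk] using this

lemma sampleMean_nonneg {m : ℕ} (S : Fin m → X × Y) {φ : X → Y → ℝ} (hφ : ∀ x y, 0 ≤ φ x y) :
    0 ≤ sampleMean S φ :=
  mul_nonneg (by positivity) (Finset.sum_nonneg fun _ _ => hφ _ _)

lemma empAddRisk_eq (L : Y → Y → ℝ) {m : ℕ} (S : Fin m → X × Y) (ρ τ : ℝ) (h : X → Y → ℝ) :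
    empAddRisk L S ρ τ h = sampleMean S fun x => marginLoss (lossMax L) L 1 ρ τ (h x) := by
  unfold empAddRisk sampleMean
  simp_rw [addLoss_eq_marginLoss]

lemma empMultRisk_eq (L : Y → Y → ℝ) {m : ℕ} (S : Fin m → X × Y) (ρ τ : ℝ) (h : X → Y → ℝ) :
    empMultRisk L S ρ τ h = sampleMean S fun x => marginLoss (lossMax L) L L ρ τ (h x) := by
  unfold empMultRisk sampleMean
  simp_rw [multLoss_eq_marginLoss]

end Main

theorem theorem12 {X : Type w} {Y : Type u} [MeasurableSpace X] [Fintype Y] [MeasurableSpace Y]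
    [MeasurableSingletonClass Y]
    (D : Measure (X × Y)) [IsProbabilityMeasure D]
    (G : X × Y → OutputGraph.{u, v} Y)
    (L : Y → Y → ℝ) (hL_nonneg : ∀ y y', 0 ≤ L y y') (hL_definite : ∀ y y', L y y' = 0 ↔ y = y')
    (m : ℕ) (hm : 1 ≤ m) (p : ℕ) (hp : 2 ≤ p)
    (H : Fin p → Set (FactoredScore G))
    (hH_range : ∀ k, ∀ h ∈ H k, ∀ x y, h.score x y ∈ Icc (0 : ℝ) 1)
    (hH_meas : ∀ k, ∀ h ∈ H k, ∀ y, Measurable fun x => h.score x y)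
    (hH_sep : ∀ k, PointwiseSeparable (FactoredScore.score '' H k))
    (ρ : ℝ) (hρ : 0 < ρ) (δ : ℝ) (hδ : 0 < δ) :
    ∃ A : Set (Fin m → X × Y), MeasurableSet A ∧
      1 - δ ≤ (Measure.pi fun _ : Fin m => D).real A ∧
      ∀ S ∈ A, ∀ (T : ℕ) (α : Fin T → ℝ) (κ : Fin T → Fin p) (h : Fin T → FactoredScore G),
        α ∈ stdSimplex ℝ (Fin T) → (∀ t, h t ∈ H (κ t)) →
        ∀ g : X → Y, Measurable g → IsPredictor (ensemble α h) g →
          ((risk D L g - empAddRisk L S ρ 1 (ensemble α h) : ℝ) : EReal) ≤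
              ((4 * Real.sqrt 2 / ρ : ℝ) : EReal) *
                  ∑ t, (α t : EReal) * empRademacher G S (H (κ t)) +
                ((vrmConst ρ (lossMax L) (Fintype.card Y) m p δ : ℝ) : EReal) ∧
          ((risk D L g - empMultRisk L S ρ 1 (ensemble α h) : ℝ) : EReal) ≤
              ((4 * Real.sqrt 2 * lossMax L / ρ : ℝ) : EReal) *
                  ∑ t, (α t : EReal) * empRademacher G S (H (κ t)) +
                ((vrmConst ρ (lossMax L) (Fintype.card Y) m p δ : ℝ) : EReal) := by
  obtain ⟨y₀⟩ : Nonempty Y := (nonempty_of_isProbabilityMeasure D).map Prod.snd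
  set M := lossMax L with hMdef
  set C := vrmConst ρ M (Fintype.card Y) m p δ with hCdef
  have hM : 0 ≤ M := (hL_nonneg y₀ y₀).trans (le_lossMax L _ _)
  have hL_zero : ∀ y, L y y = 0 := fun y => (hL_definite y y).2 rfl
  rcases le_or_gt 1 δ with hδ1 | hδ1
  · exact ⟨∅, MeasurableSet.empty, by simpa using hδ1, fun S hS => absurd hS (notMem_empty S)⟩
  -- If `C ≥ M` the bounds are trivial, as the risk is at most `M`. Otherwise the logarithm is
  -- positive and the ceiling is a natural number `n ≥ 1`.
  rcases le_or_gt M C with hMC | hCM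
  · refine ⟨univ, MeasurableSet.univ, by simpa using hδ.le, fun S _ T α κ h hα hh g _ _ => ?_⟩
    have hR : ∀ t, 0 ≤ empRademacher G S (H (κ t)) := fun t => empRademacher_nonneg S ⟨h t, hh t⟩
    have hsum := sum_coe_mul_nonneg hα.1 hR
    have hrisk := (risk_le_lossMax D hL_nonneg g).trans hMC
    have h1 : 0 ≤ empAddRisk L S ρ 1 (ensemble α h) :=
      sampleMean_nonneg S fun x y => (truncate_mem_Icc hM _).1
    have h2 : 0 ≤ empMultRisk L S ρ 1 (ensemble α h) :=
      sampleMean_nonneg S fun x y => (truncate_mem_Icc hM _).1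
    constructor
    · refine (EReal.coe_le_coe_iff.2 (show _ ≤ C by linarith)).trans (le_add_of_nonneg_left ?_)
      exact mul_nonneg (EReal.coe_nonneg.2 (by positivity)) hsum
    · refine (EReal.coe_le_coe_iff.2 (show _ ≤ C by linarith)).trans (le_add_of_nonneg_left ?_)
      exact mul_nonneg (EReal.coe_nonneg.2 (by positivity)) hsum
  have hM0 : 0 < M := (vrmConst_nonneg hρ hM _ _ _ _).trans_lt hCM
  have hq := one_lt_of_vrmConst_lt hρ hM (Fintype.card_pos_iff.2 ⟨y₀⟩) hm hp hCM
  have hlog : 0 < Real.log p := Real.log_pos (by exact_mod_cast hp)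
  have hlogδ : 0 < Real.log (2 / δ) := Real.log_pos (by rw [lt_div_iff₀ hδ]; linarith)
  obtain ⟨n, hn⟩ := Int.eq_ofNat_of_zero_le (Int.ceil_nonneg (mul_nonneg
    (show 0 ≤ 4 / ρ ^ 2 by positivity) (Real.log_pos hq).le))
  have hn1 : 1 ≤ n := by
    have : 0 < ⌈4 / ρ ^ 2 * Real.log ((Fintype.card Y : ℝ) ^ 2 * ρ ^ 2 * m / (4 * Real.log p))⌉ :=
      Int.ceil_pos.2 (mul_pos (by positivity) (Real.log_pos hq))
    rw [hn] at this
    exact_mod_cast this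
  have hconst := card_mul_exp_add_le_vrmConst hρ hM hm hp hδ hδ1 hq hn.symm
  -- Chosen so that `exp(-s) = δ / (2 p ^ n)`: one share for each of the `p ^ n` classes and each of
  -- the two losses.
  set s := n * Real.log p + Real.log (2 / δ) with hs
  have hs0 : 0 ≤ s := by positivity
  choose A₁ hA₁m hA₁ hA₁S using fun k : Fin n → Fin p => exists_tuple_deviation_event (M := M)
    (τ := 1 / 2) (a := L) (b := 1) (B := 1) D hm hρ hM0 zero_le_one (fun _ _ => zero_le_one)
    (fun _ _ => le_rfl) (fun l => H (k l)) (fun l => hH_meas (k l)) (fun l => hH_sep (k l)) hs0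
  choose A₂ hA₂m hA₂ hA₂S using fun k : Fin n → Fin p => exists_tuple_deviation_event (M := M)
    (τ := 1 / 2) (a := L) (b := L) (B := M) D hm hρ hM0 hM hL_nonneg
    (le_lossMax L) (fun l => H (k l)) (fun l => hH_meas (k l)) (fun l => hH_sep (k l)) hs0
  have hAm : MeasurableSet (⋂ k, A₁ k ∩ A₂ k) :=
    MeasurableSet.iInter fun k => (hA₁m k).inter (hA₂m k)
  refine ⟨⋂ k, A₁ k ∩ A₂ k, hAm, ?_, fun S hS T α κ h hα hh g hgm hg => ?_⟩
  · set ν := Measure.pi fun _ : Fin m => D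
    have hexp : Real.exp (-s) = δ / 2 / (p : ℝ) ^ n := by
      have hp0 : (0 : ℝ) < p := by positivity
      rw [hs, neg_add, Real.exp_add, ← Real.log_inv, Real.exp_log (by positivity), ← Real.log_pow,
        ← Real.log_inv, Real.exp_log (by positivity)]
      field_simp
    have hcompl : ν.real (⋂ k, A₁ k ∩ A₂ k)ᶜ ≤ δ := by
      rw [compl_iInter]
      calc ν.real (⋃ k, (A₁ k ∩ A₂ k)ᶜ) ≤ ∑ k, ν.real (A₁ k ∩ A₂ k)ᶜ :=
            measureReal_iUnion_fintype_le _
        _ ≤ ∑ k : Fin n → Fin p, (Real.exp (-s) + Real.exp (-s)) := by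
            refine Finset.sum_le_sum fun k _ => ?_
            rw [compl_inter]
            exact (measureReal_union_le _ _).trans (add_le_add (hA₁ k) (hA₂ k))
        _ = δ := by
            have hp0 : (p : ℝ) ≠ 0 := by positivity
            simp only [Finset.sum_const, Finset.card_univ, Fintype.card_fun, Fintype.card_fin,
              nsmul_eq_mul, hexp]
            push_cast
            field_simp
            norm_num
    rw [probReal_compl_eq_one_sub hAm] at hcompl
    linarith
  rw [mem_iInter] at hS
  have hR : ∀ t, 0 ≤ empRademacher G S (H (κ t)) := fun t => empRademacher_nonneg S ⟨h t, hh t⟩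
  constructor
  · refine coe_le_coe_mul_sum_add hα.1 hR (by positivity) fun hfin => ?_
    have := risk_le_of_tuple_bounds (b := 1) (B := 1) (K := 4 * √2 * 1 / ρ)
      (ξ := 3 * M * √(s / (2 * m))) D hL_nonneg hL_zero hρ
      (fun _ _ => zero_le_one) (fun _ _ => le_rfl) hm hn1 S hα h
      (fun t => hH_range _ _ (hh t)) (fun t => hH_meas _ _ (hh t))
      (fun t => (empRademacher G S (H (κ t))).toReal)
      (fun t ht => hA₁S (fun j => κ (t j)) S (hS _).1 (fun j => h (t j)) (fun j => hh (t j))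
        (fun j => (empRademacher G S (H (κ (t j)))).toReal) fun j => hfin (t j) (ht j)) hgm hg
    rw [empAddRisk_eq, ← hMdef]
    rw [← hMdef] at this
    rw [mul_one] at this
    linarith
  · refine coe_le_coe_mul_sum_add hα.1 hR (by positivity) fun hfin => ?_
    have := risk_le_of_tuple_bounds (b := L) (B := M) (K := 4 * √2 * M / ρ)
      (ξ := 3 * M * √(s / (2 * m))) D hL_nonneg hL_zero hρ
      hL_nonneg (le_lossMax L) hm hn1 S hα h
      (fun t => hH_range _ _ (hh t)) (fun t => hH_meas _ _ (hh t))
      (fun t => (empRademacher G S (H (κ t))).toReal)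
      (fun t ht => hA₂S (fun j => κ (t j)) S (hS _).2 (fun j => h (t j)) (fun j => hh (t j))
        (fun j => (empRademacher G S (H (κ (t j)))).toReal) fun j => hfin (t j) (ht j)) hgm hg
    rw [empMultRisk_eq, ← hMdef]
    rw [← hMdef] at this
    linarith
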